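/- Let $\mathbf{Cat}$ be the bicategory of categories (of fixed universe levels), functors and natural transformations. Compositions are written in diagrammatic order: $f\cdot g$ for 1-cells, $\theta\bullet\gamma$ for vertical composition of 2-cells; $\vartriangleleft$, $\vartriangleright$ denote left and right whiskering, and the coherence isomorphisms of bicategories are left implicit in the equations below. *Monads.* For a bicategory $\mathbf B$ let $\mathbf M(\mathbf B)$ be the displayed bicategory over $\mathbf B$ in which: - a displayed object over $a$ is a monad structure on $a$: a 1-cell $m_a:a\to a$ with 2-cells $\eta_a:\mathrm{id}\Rightarrow m_a$ and $\mu_a:m_a\cdot m_a\Rightarrow m_a$ such that $(m_a\vartriangleleft\eta_a)\bullet\mu_a=\mathrm{id}=(\eta_a\vartriangleright m_a)\bullet\mu_a$ and $(m_a\vartriangleleft\mu_a)\bullet\mu_a=(\mu_a\vartriangleright m_a)\bullet\mu_a$; - a displayed 1-cell over $f:a\to b$ is an invertible 2-cell $n_f:m_a\cdot f\Rightarrow f\cdot m_b$ with $(\eta_a\vartriangleright f)\bullet n_f=f\vartriangleleft\eta_b$ and $(\mu_a\vartriangleright f)\bullet n_f=(m_a\vartriangleleft n_f)\bullet(n_f\vartriangleright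 m_b)\bullet(f\vartriangleleft\mu_b)$; - a displayed 2-cell over $x:f\Rightarrow g$ from $n_f$ to $n_g$ is a proof that $(m_a\vartriangleleft x)\bullet n_g=n_f\bullet(x\vartriangleright m_b)$. Its total bicategory (objects: pairs of an object of $\mathbf B$ and a displayed object over it; likewise for 1-cells and 2-cells) is the bicategory of monads internal to $\mathbf B$. *Kleisli triples.* Let $\mathbf K$ be the displayed bicategory over $\mathbf{Cat}$ in which: - a displayed object over a category $C$ is a Kleisli triple on $C$: a function $M:C_0\to C_0$, arrows $\eta(a):a\to M(a)$, and for each arrow $f:a\to M(b)$ an arrow $f^*:M(a)\to M(b)$, such that $\eta(a)^*=\mathrm{id}$, $\eta(a)\cdot f^*=f$ and $f^*\cdot g^*=(f\cdot g^*)^*$; one writes $M(h)=(h\cdot\eta(b))^*$ for $h:a\to b$; - a displayed 1-cell over a functor $F:C\to D$ from $M_C$ to $M_D$ is a family of isomorphisms $F_M(a):M_D(F(a))\cong F(M_C(a))$ $(a\in C_0)$ with $\eta_D(F(a))\cdot F_M(a)=F(\eta_C(a))$ and $(F(f)\cdot F_M(b)^{-1})^*\cdot F_M(b)=F_M(a)\cdot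 F(f^*)$ for all $f:a\to M_C(b)$; - a displayed 2-cell over $n:F\Rightarrow G$ from $F_M$ to $G_M$ is a proof that $F_M(a)\cdot n(M_C(a))=M_D(n(a))\cdot G_M(a)$ for all $a$. Its total bicategory is the bicategory of Kleisli triples. *Biequivalences.* A biequivalence between bicategories consists of pseudofunctors $L$ and $R$ in the two directions, pseudonatural transformations both ways between $R\cdot L$ and the identity and both ways between $L\cdot R$ and the identity, and invertible modifications from the four composites of these transformations to the corresponding identity transformations. A displayed biequivalence over a biequivalence consists of displayed pseudofunctors, displayed pseudonatural transformations and displayed invertible modifications lying over these data; passing to total bicategories turns it into a biequivalence between the total bicategories. **Claim.** There is a displayed biequivalence from $\mathbf M(\mathbf{Cat})$ to $\mathbf K$ over the identity biequivalence of $\mathbf{Cat}$. Consequently its total biequivalence is a biequivalence between the bicategory of monads internal to $\mathbf{Cat}$ and the bicategory of Kleisli triples. -/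

import Mathlib

open CategoryTheory Bicategory
open scoped Pseudofunctor.StrongTrans

set_option linter.checkUnivs false

universe v u w₁ v₁ u₁ w₂ v₂ u₂ w₃ v₃ u₃ w₁' v₁' u₁' w₂' v₂' u₂' w₃' v₃' u₃'

/-! ## Displayed bicategories -/

/-- The cells and the identities and compositions of a displayed bicategory over `B`. -/
structure DispBicatData (B : Type u₁) [Bicategory.{w₁, v₁} B] where
  /-- displayed 0-cells over `a` -/
  Obj : B → Type u₁'
  /-- displayed 1-cells over `f` -/
  Hom : {a b : B} → (a ⟶ b) → Obj a → Obj b → Type v₁'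
  /-- displayed 2-cells over `θ` -/
  Hom₂ : {a b : B} → {f g : a ⟶ b} → (f ⟶ g) → {x : Obj a} → {y : Obj b} →
    Hom f x y → Hom g x y → Type w₁'
  id₁ {a : B} (x : Obj a) : Hom (𝟙 a) x x
  comp₁ {a b c : B} {f : a ⟶ b} {g : b ⟶ c} {x : Obj a} {y : Obj b} {z : Obj c}
    (ff : Hom f x y) (gg : Hom g y z) : Hom (f ≫ g) x z
  id₂ {a b : B} {f : a ⟶ b} {x : Obj a} {y : Obj b} (ff : Hom f x y) : Hom₂ (𝟙 f) ff ff
  comp₂ {a b : B} {f g h : a ⟶ b} {θ : f ⟶ g} {γ : g ⟶ h} {x : Obj a} {y : Obj b}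
    {ff : Hom f x y} {gg : Hom g x y} {hh : Hom h x y}
    (θθ : Hom₂ θ ff gg) (γγ : Hom₂ γ gg hh) : Hom₂ (θ ≫ γ) ff hh

/-- A displayed invertible 2-cell over an invertible 2-cell `e`. Equations between displayed
2-cells hold over the corresponding equation between 2-cells of the base, and are written with
heterogeneous equality. -/
structure DispIso {B : Type u₁} [Bicategory.{w₁, v₁} B] (D : DispBicatData.{w₁, v₁, u₁, w₁', v₁', u₁'} B)
    {a b : B} {f g : a ⟶ b} (e : f ≅ g) {x : D.Obj a} {y : D.Obj b}
    (ff : D.Hom f x y) (gg : D.Hom g x y) where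
  hom : D.Hom₂ e.hom ff gg
  inv : D.Hom₂ e.inv gg ff
  hom_inv : HEq (D.comp₂ hom inv) (D.id₂ ff)
  inv_hom : HEq (D.comp₂ inv hom) (D.id₂ gg)

/-- A displayed bicategory over `B`: the operations and the laws are those of
`CategoryTheory.Bicategory`, each lying over the corresponding operation or law of `B`. -/
structure DispBicat (B : Type u₁) [Bicategory.{w₁, v₁} B] extends
    DispBicatData.{w₁, v₁, u₁, w₁', v₁', u₁'} B where
  whiskerLeft {a b c : B} {f : a ⟶ b} {g h : b ⟶ c} {θ : g ⟶ h}
    {x : Obj a} {y : Obj b} {z : Obj c} (ff : Hom f x y) {gg : Hom g y z} {hh : Hom h y z}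
    (θθ : Hom₂ θ gg hh) : Hom₂ (f ◁ θ) (comp₁ ff gg) (comp₁ ff hh)
  whiskerRight {a b c : B} {f g : a ⟶ b} {θ : f ⟶ g} {h : b ⟶ c}
    {x : Obj a} {y : Obj b} {z : Obj c} {ff : Hom f x y} {gg : Hom g x y}
    (θθ : Hom₂ θ ff gg) (hh : Hom h y z) : Hom₂ (θ ▷ h) (comp₁ ff hh) (comp₁ gg hh)
  associator {a b c d : B} {f : a ⟶ b} {g : b ⟶ c} {h : c ⟶ d}
    {x : Obj a} {y : Obj b} {z : Obj c} {t : Obj d}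
    (ff : Hom f x y) (gg : Hom g y z) (hh : Hom h z t) :
    DispIso toDispBicatData (α_ f g h) (comp₁ (comp₁ ff gg) hh) (comp₁ ff (comp₁ gg hh))
  leftUnitor {a b : B} {f : a ⟶ b} {x : Obj a} {y : Obj b} (ff : Hom f x y) :
    DispIso toDispBicatData (λ_ f) (comp₁ (id₁ x) ff) ff
  rightUnitor {a b : B} {f : a ⟶ b} {x : Obj a} {y : Obj b} (ff : Hom f x y) :
    DispIso toDispBicatData (ρ_ f) (comp₁ ff (id₁ y)) ff
  id_comp {a b : B} {f g : a ⟶ b} {θ : f ⟶ g} {x : Obj a} {y : Obj b}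
    {ff : Hom f x y} {gg : Hom g x y} (θθ : Hom₂ θ ff gg) : HEq (comp₂ (id₂ ff) θθ) θθ
  comp_id {a b : B} {f g : a ⟶ b} {θ : f ⟶ g} {x : Obj a} {y : Obj b}
    {ff : Hom f x y} {gg : Hom g x y} (θθ : Hom₂ θ ff gg) : HEq (comp₂ θθ (id₂ gg)) θθ
  assoc {a b : B} {f g h i : a ⟶ b} {θ : f ⟶ g} {γ : g ⟶ h} {τ : h ⟶ i} {x : Obj a} {y : Obj b}
    {ff : Hom f x y} {gg : Hom g x y} {hh : Hom h x y} {ii : Hom i x y}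
    (θθ : Hom₂ θ ff gg) (γγ : Hom₂ γ gg hh) (ττ : Hom₂ τ hh ii) :
    HEq (comp₂ (comp₂ θθ γγ) ττ) (comp₂ θθ (comp₂ γγ ττ))
  whiskerLeft_id {a b c : B} {f : a ⟶ b} {g : b ⟶ c} {x : Obj a} {y : Obj b} {z : Obj c}
    (ff : Hom f x y) (gg : Hom g y z) :
    HEq (whiskerLeft ff (id₂ gg)) (id₂ (comp₁ ff gg))
  whiskerLeft_comp {a b c : B} {f : a ⟶ b} {g h i : b ⟶ c} {θ : g ⟶ h} {γ : h ⟶ i}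
    {x : Obj a} {y : Obj b} {z : Obj c} (ff : Hom f x y)
    {gg : Hom g y z} {hh : Hom h y z} {ii : Hom i y z} (θθ : Hom₂ θ gg hh) (γγ : Hom₂ γ hh ii) :
    HEq (whiskerLeft ff (comp₂ θθ γγ)) (comp₂ (whiskerLeft ff θθ) (whiskerLeft ff γγ))
  id_whiskerLeft {a b : B} {f g : a ⟶ b} {θ : f ⟶ g} {x : Obj a} {y : Obj b}
    {ff : Hom f x y} {gg : Hom g x y} (θθ : Hom₂ θ ff gg) :
    HEq (whiskerLeft (id₁ x) θθ) (comp₂ (leftUnitor ff).hom (comp₂ θθ (leftUnitor gg).inv))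
  comp_whiskerLeft {a b c d : B} {f : a ⟶ b} {g : b ⟶ c} {h h' : c ⟶ d} {θ : h ⟶ h'}
    {x : Obj a} {y : Obj b} {z : Obj c} {t : Obj d}
    (ff : Hom f x y) (gg : Hom g y z) {hh : Hom h z t} {hh' : Hom h' z t} (θθ : Hom₂ θ hh hh') :
    HEq (whiskerLeft (comp₁ ff gg) θθ)
      (comp₂ (associator ff gg hh).hom
        (comp₂ (whiskerLeft ff (whiskerLeft gg θθ)) (associator ff gg hh').inv))
  id_whiskerRight {a b c : B} {f : a ⟶ b} {g : b ⟶ c} {x : Obj a} {y : Obj b} {z : Obj c}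
    (ff : Hom f x y) (gg : Hom g y z) :
    HEq (whiskerRight (id₂ ff) gg) (id₂ (comp₁ ff gg))
  comp_whiskerRight {a b c : B} {f g h : a ⟶ b} {i : b ⟶ c} {θ : f ⟶ g} {γ : g ⟶ h}
    {x : Obj a} {y : Obj b} {z : Obj c}
    {ff : Hom f x y} {gg : Hom g x y} {hh : Hom h x y}
    (θθ : Hom₂ θ ff gg) (γγ : Hom₂ γ gg hh) (ii : Hom i y z) :
    HEq (whiskerRight (comp₂ θθ γγ) ii) (comp₂ (whiskerRight θθ ii) (whiskerRight γγ ii))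
  whiskerRight_id {a b : B} {f g : a ⟶ b} {θ : f ⟶ g} {x : Obj a} {y : Obj b}
    {ff : Hom f x y} {gg : Hom g x y} (θθ : Hom₂ θ ff gg) :
    HEq (whiskerRight θθ (id₁ y)) (comp₂ (rightUnitor ff).hom (comp₂ θθ (rightUnitor gg).inv))
  whiskerRight_comp {a b c d : B} {f f' : a ⟶ b} {g : b ⟶ c} {h : c ⟶ d} {θ : f ⟶ f'}
    {x : Obj a} {y : Obj b} {z : Obj c} {t : Obj d}
    {ff : Hom f x y} {ff' : Hom f' x y} (θθ : Hom₂ θ ff ff') (gg : Hom g y z) (hh : Hom h z t) :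
    HEq (whiskerRight θθ (comp₁ gg hh))
      (comp₂ (associator ff gg hh).inv
        (comp₂ (whiskerRight (whiskerRight θθ gg) hh) (associator ff' gg hh).hom))
  whisker_assoc {a b c d : B} {f : a ⟶ b} {g g' : b ⟶ c} {h : c ⟶ d} {θ : g ⟶ g'}
    {x : Obj a} {y : Obj b} {z : Obj c} {t : Obj d}
    (ff : Hom f x y) {gg : Hom g y z} {gg' : Hom g' y z} (θθ : Hom₂ θ gg gg') (hh : Hom h z t) :
    HEq (whiskerRight (whiskerLeft ff θθ) hh)
      (comp₂ (associator ff gg hh).hom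
        (comp₂ (whiskerLeft ff (whiskerRight θθ hh)) (associator ff gg' hh).inv))
  whisker_exchange {a b c : B} {f g : a ⟶ b} {h i : b ⟶ c} {θ : f ⟶ g} {γ : h ⟶ i}
    {x : Obj a} {y : Obj b} {z : Obj c}
    {ff : Hom f x y} {gg : Hom g x y} {hh : Hom h y z} {ii : Hom i y z}
    (θθ : Hom₂ θ ff gg) (γγ : Hom₂ γ hh ii) :
    HEq (comp₂ (whiskerLeft ff γγ) (whiskerRight θθ ii))
      (comp₂ (whiskerRight θθ hh) (whiskerLeft gg γγ))
  pentagon {a b c d e : B} {f : a ⟶ b} {g : b ⟶ c} {h : c ⟶ d} {i : d ⟶ e}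
    {x : Obj a} {y : Obj b} {z : Obj c} {t : Obj d} {s : Obj e}
    (ff : Hom f x y) (gg : Hom g y z) (hh : Hom h z t) (ii : Hom i t s) :
    HEq (comp₂ (whiskerRight (associator ff gg hh).hom ii)
        (comp₂ (associator ff (comp₁ gg hh) ii).hom (whiskerLeft ff (associator gg hh ii).hom)))
      (comp₂ (associator (comp₁ ff gg) hh ii).hom (associator ff gg (comp₁ hh ii)).hom)
  triangle {a b c : B} {f : a ⟶ b} {g : b ⟶ c} {x : Obj a} {y : Obj b} {z : Obj c}
    (ff : Hom f x y) (gg : Hom g y z) :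
    HEq (comp₂ (associator ff (id₁ y) gg).hom (whiskerLeft ff (leftUnitor gg).hom))
      (whiskerRight (rightUnitor ff).hom gg)

/-! ## The total bicategory -/

section TotalSection

variable {B : Type u₁} [Bicategory.{w₁, v₁} B]

/-- 0-cells of the total bicategory. -/
structure TotalBicat (D : DispBicat.{w₁, v₁, u₁, w₁', v₁', u₁'} B) where
  base : B
  disp : D.Obj base

variable {D : DispBicat.{w₁, v₁, u₁, w₁', v₁', u₁'} B}

/-- 1-cells of the total bicategory. -/
structure TotalBicat.Hom (x y : TotalBicat D) where
  base : x.base ⟶ y.base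
  disp : D.Hom base x.disp y.disp

instance : CategoryStruct (TotalBicat D) where
  Hom x y := TotalBicat.Hom x y
  id x := ⟨𝟙 x.base, D.id₁ x.disp⟩
  comp f g := ⟨f.base ≫ g.base, D.comp₁ f.disp g.disp⟩

/-- 2-cells of the total bicategory. -/
@[ext]
structure TotalBicat.Hom₂ {x y : TotalBicat D} (f g : x ⟶ y) where
  base : f.base ⟶ g.base
  disp : D.Hom₂ base f.disp g.disp

instance (x y : TotalBicat D) : Category (x ⟶ y) where
  Hom f g := TotalBicat.Hom₂ f g
  id f := ⟨𝟙 f.base, D.id₂ f.disp⟩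
  comp θ γ := ⟨θ.base ≫ γ.base, D.comp₂ θ.disp γ.disp⟩
  id_comp _ := TotalBicat.Hom₂.ext (Category.id_comp _) (D.id_comp _)
  comp_id _ := TotalBicat.Hom₂.ext (Category.comp_id _) (D.comp_id _)
  assoc _ _ _ := TotalBicat.Hom₂.ext (Category.assoc _ _ _) (D.assoc _ _ _)

/-- The total 1-cell of a displayed 1-cell. -/
abbrev TotalBicat.mkHom {x y : TotalBicat D} (f : x.base ⟶ y.base) (ff : D.Hom f x.disp y.disp) : x ⟶ y :=
  TotalBicat.Hom.mk f ff

/-- The total 2-cell of a displayed 2-cell. -/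
abbrev TotalBicat.mkHom₂ {x y : TotalBicat D} {f g : x ⟶ y} (θ : f.base ⟶ g.base)
    (θθ : D.Hom₂ θ f.disp g.disp) : f ⟶ g :=
  TotalBicat.Hom₂.mk θ θθ

theorem TotalBicat.ext₂ {x y : TotalBicat D} {f g : x ⟶ y} {θ γ : f ⟶ g} (h : θ.base = γ.base)
    (hh : HEq θ.disp γ.disp) : θ = γ :=
  TotalBicat.Hom₂.ext h hh

theorem TotalBicat.heq {x y : TotalBicat D} {f g : x ⟶ y} {θ γ : f ⟶ g} (h : θ = γ) :
    HEq θ.disp γ.disp := by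
  subst h; rfl

/-- The total invertible 2-cell of a displayed invertible 2-cell. -/
def TotalBicat.mkIso {x y : TotalBicat D} {f g : x ⟶ y} (e : f.base ≅ g.base)
    (ee : DispIso D.toDispBicatData e f.disp g.disp) : f ≅ g where
  hom := TotalBicat.mkHom₂ e.hom ee.hom
  inv := TotalBicat.mkHom₂ e.inv ee.inv
  hom_inv_id := TotalBicat.ext₂ e.hom_inv_id ee.hom_inv
  inv_hom_id := TotalBicat.ext₂ e.inv_hom_id ee.inv_hom

/-- The total bicategory of a displayed bicategory. -/
instance : Bicategory (TotalBicat D) where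
  homCategory _ _ := inferInstance
  whiskerLeft f _ _ θ := TotalBicat.mkHom₂ (f.base ◁ θ.base) (D.whiskerLeft f.disp θ.disp)
  whiskerRight θ h := TotalBicat.mkHom₂ (θ.base ▷ h.base) (D.whiskerRight θ.disp h.disp)
  associator f g h := TotalBicat.mkIso (α_ f.base g.base h.base) (D.associator f.disp g.disp h.disp)
  leftUnitor f := TotalBicat.mkIso (λ_ f.base) (D.leftUnitor f.disp)
  rightUnitor f := TotalBicat.mkIso (ρ_ f.base) (D.rightUnitor f.disp)
  whiskerLeft_id _ _ := TotalBicat.ext₂ (Bicategory.whiskerLeft_id _ _) (D.whiskerLeft_id _ _)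
  whiskerLeft_comp _ _ _ _ _ _ :=
    TotalBicat.ext₂ (Bicategory.whiskerLeft_comp _ _ _) (D.whiskerLeft_comp _ _ _)
  id_whiskerLeft _ := TotalBicat.ext₂ (Bicategory.id_whiskerLeft _) (D.id_whiskerLeft _)
  comp_whiskerLeft _ _ _ _ _ :=
    TotalBicat.ext₂ (Bicategory.comp_whiskerLeft _ _ _) (D.comp_whiskerLeft _ _ _)
  id_whiskerRight _ _ := TotalBicat.ext₂ (Bicategory.id_whiskerRight _ _) (D.id_whiskerRight _ _)
  comp_whiskerRight _ _ _ :=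
    TotalBicat.ext₂ (Bicategory.comp_whiskerRight _ _ _) (D.comp_whiskerRight _ _ _)
  whiskerRight_id _ := TotalBicat.ext₂ (Bicategory.whiskerRight_id _) (D.whiskerRight_id _)
  whiskerRight_comp _ _ _ :=
    TotalBicat.ext₂ (Bicategory.whiskerRight_comp _ _ _) (D.whiskerRight_comp _ _ _)
  whisker_assoc _ _ _ _ _ :=
    TotalBicat.ext₂ (Bicategory.whisker_assoc _ _ _) (D.whisker_assoc _ _ _)
  whisker_exchange _ _ :=
    TotalBicat.ext₂ (Bicategory.whisker_exchange _ _) (D.whisker_exchange _ _)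
  pentagon _ _ _ _ := TotalBicat.ext₂ (Bicategory.pentagon _ _ _ _) (D.pentagon _ _ _ _)
  triangle _ _ := TotalBicat.ext₂ (Bicategory.triangle _ _) (D.triangle _ _)

end TotalSection

/-! ## Displayed pseudofunctors -/

section DispPseudofunctor

variable {B : Type u₁} [Bicategory.{w₁, v₁} B] {C : Type u₂} [Bicategory.{w₂, v₂} C]
  {A : Type u₃} [Bicategory.{w₃, v₃} A]

/-- A displayed pseudofunctor over `F`: the data and the laws are those of
`CategoryTheory.Pseudofunctor`, each lying over the corresponding datum or law of `F`. -/
structure DispPseudofunctor (F : B ⥤ᵖ C) (D : DispBicat.{w₁, v₁, u₁, w₁', v₁', u₁'} B)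
    (E : DispBicat.{w₂, v₂, u₂, w₂', v₂', u₂'} C) where
  obj {a : B} (x : D.Obj a) : E.Obj (F.obj a)
  map {a b : B} {f : a ⟶ b} {x : D.Obj a} {y : D.Obj b} (ff : D.Hom f x y) :
    E.Hom (F.map f) (obj x) (obj y)
  map₂ {a b : B} {f g : a ⟶ b} {θ : f ⟶ g} {x : D.Obj a} {y : D.Obj b}
    {ff : D.Hom f x y} {gg : D.Hom g x y} (θθ : D.Hom₂ θ ff gg) :
    E.Hom₂ (F.map₂ θ) (map ff) (map gg)
  mapId {a : B} (x : D.Obj a) :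
    DispIso E.toDispBicatData (F.mapId a) (map (D.id₁ x)) (E.id₁ (obj x))
  mapComp {a b c : B} {f : a ⟶ b} {g : b ⟶ c} {x : D.Obj a} {y : D.Obj b} {z : D.Obj c}
    (ff : D.Hom f x y) (gg : D.Hom g y z) :
    DispIso E.toDispBicatData (F.mapComp f g) (map (D.comp₁ ff gg)) (E.comp₁ (map ff) (map gg))
  map₂_id {a b : B} {f : a ⟶ b} {x : D.Obj a} {y : D.Obj b} (ff : D.Hom f x y) :
    HEq (map₂ (D.id₂ ff)) (E.id₂ (map ff))
  map₂_comp {a b : B} {f g h : a ⟶ b} {θ : f ⟶ g} {γ : g ⟶ h} {x : D.Obj a} {y : D.Obj b}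
    {ff : D.Hom f x y} {gg : D.Hom g x y} {hh : D.Hom h x y}
    (θθ : D.Hom₂ θ ff gg) (γγ : D.Hom₂ γ gg hh) :
    HEq (map₂ (D.comp₂ θθ γγ)) (E.comp₂ (map₂ θθ) (map₂ γγ))
  map₂_whiskerLeft {a b c : B} {f : a ⟶ b} {g h : b ⟶ c} {θ : g ⟶ h}
    {x : D.Obj a} {y : D.Obj b} {z : D.Obj c} (ff : D.Hom f x y)
    {gg : D.Hom g y z} {hh : D.Hom h y z} (θθ : D.Hom₂ θ gg hh) :
    HEq (map₂ (D.whiskerLeft ff θθ))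
      (E.comp₂ (mapComp ff gg).hom
        (E.comp₂ (E.whiskerLeft (map ff) (map₂ θθ)) (mapComp ff hh).inv))
  map₂_whiskerRight {a b c : B} {f g : a ⟶ b} {h : b ⟶ c} {θ : f ⟶ g}
    {x : D.Obj a} {y : D.Obj b} {z : D.Obj c} {ff : D.Hom f x y} {gg : D.Hom g x y}
    (θθ : D.Hom₂ θ ff gg) (hh : D.Hom h y z) :
    HEq (map₂ (D.whiskerRight θθ hh))
      (E.comp₂ (mapComp ff hh).hom
        (E.comp₂ (E.whiskerRight (map₂ θθ) (map hh)) (mapComp gg hh).inv))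
  map₂_associator {a b c d : B} {f : a ⟶ b} {g : b ⟶ c} {h : c ⟶ d}
    {x : D.Obj a} {y : D.Obj b} {z : D.Obj c} {t : D.Obj d}
    (ff : D.Hom f x y) (gg : D.Hom g y z) (hh : D.Hom h z t) :
    HEq (map₂ (D.associator ff gg hh).hom)
      (E.comp₂ (mapComp (D.comp₁ ff gg) hh).hom
        (E.comp₂ (E.whiskerRight (mapComp ff gg).hom (map hh))
          (E.comp₂ (E.associator (map ff) (map gg) (map hh)).hom
            (E.comp₂ (E.whiskerLeft (map ff) (mapComp gg hh).inv)
              (mapComp ff (D.comp₁ gg hh)).inv))))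
  map₂_leftUnitor {a b : B} {f : a ⟶ b} {x : D.Obj a} {y : D.Obj b} (ff : D.Hom f x y) :
    HEq (map₂ (D.leftUnitor ff).hom)
      (E.comp₂ (mapComp (D.id₁ x) ff).hom
        (E.comp₂ (E.whiskerRight (mapId x).hom (map ff)) (E.leftUnitor (map ff)).hom))
  map₂_rightUnitor {a b : B} {f : a ⟶ b} {x : D.Obj a} {y : D.Obj b} (ff : D.Hom f x y) :
    HEq (map₂ (D.rightUnitor ff).hom)
      (E.comp₂ (mapComp ff (D.id₁ y)).hom
        (E.comp₂ (E.whiskerLeft (map ff) (mapId y).hom) (E.rightUnitor (map ff)).hom))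

variable {D : DispBicat.{w₁, v₁, u₁, w₁', v₁', u₁'} B}
  {E : DispBicat.{w₂, v₂, u₂, w₂', v₂', u₂'} C}
  {K : DispBicat.{w₃, v₃, u₃, w₃', v₃', u₃'} A}

/-- The total pseudofunctor of a displayed pseudofunctor. -/
def DispPseudofunctor.total {F : B ⥤ᵖ C} (FF : DispPseudofunctor F D E) :
    TotalBicat D ⥤ᵖ TotalBicat E where
  obj x := ⟨F.obj x.base, FF.obj x.disp⟩
  map f := TotalBicat.mkHom (F.map f.base) (FF.map f.disp)
  map₂ θ := TotalBicat.mkHom₂ (F.map₂ θ.base) (FF.map₂ θ.disp)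
  map₂_id f := TotalBicat.ext₂ (F.map₂_id f.base) (FF.map₂_id f.disp)
  map₂_comp θ γ := TotalBicat.ext₂ (F.map₂_comp θ.base γ.base) (FF.map₂_comp θ.disp γ.disp)
  mapId x := TotalBicat.mkIso (F.mapId x.base) (FF.mapId x.disp)
  mapComp f g := TotalBicat.mkIso (F.mapComp f.base g.base) (FF.mapComp f.disp g.disp)
  map₂_whisker_left f _ _ θ :=
    TotalBicat.ext₂ (F.map₂_whisker_left f.base θ.base) (FF.map₂_whiskerLeft f.disp θ.disp)
  map₂_whisker_right θ h :=
    TotalBicat.ext₂ (F.map₂_whisker_right θ.base h.base) (FF.map₂_whiskerRight θ.disp h.disp)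
  map₂_associator f g h :=
    TotalBicat.ext₂ (F.map₂_associator f.base g.base h.base)
      (FF.map₂_associator f.disp g.disp h.disp)
  map₂_left_unitor f :=
    TotalBicat.ext₂ (F.map₂_left_unitor f.base) (FF.map₂_leftUnitor f.disp)
  map₂_right_unitor f :=
    TotalBicat.ext₂ (F.map₂_right_unitor f.base) (FF.map₂_rightUnitor f.disp)

/-- The identity displayed invertible 2-cell. -/
def DispIso.refl {a b : B} {f : a ⟶ b} {x : D.Obj a} {y : D.Obj b} (ff : D.Hom f x y) :
    DispIso D.toDispBicatData (Iso.refl f) ff ff where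
  hom := D.id₂ ff
  inv := D.id₂ ff
  hom_inv := D.id_comp _
  inv_hom := D.id_comp _

/-- The inverse of a displayed invertible 2-cell. -/
def DispIso.symm {a b : B} {f g : a ⟶ b} {e : f ≅ g} {x : D.Obj a} {y : D.Obj b}
    {ff : D.Hom f x y} {gg : D.Hom g x y} (ee : DispIso D.toDispBicatData e ff gg) :
    DispIso D.toDispBicatData e.symm gg ff where
  hom := ee.inv
  inv := ee.hom
  hom_inv := ee.inv_hom
  inv_hom := ee.hom_inv

/-- An invertible 2-cell of the total bicategory gives a displayed invertible 2-cell. -/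
def DispIso.ofTotal {x y : TotalBicat D} {f g : x ⟶ y} (e : f.base ≅ g.base) (i : f ≅ g)
    (hom : D.Hom₂ e.hom f.disp g.disp) (inv : D.Hom₂ e.inv g.disp f.disp)
    (h : i.hom = TotalBicat.mkHom₂ e.hom hom) (h' : i.inv = TotalBicat.mkHom₂ e.inv inv) :
    DispIso D.toDispBicatData e f.disp g.disp where
  hom := hom
  inv := inv
  hom_inv := by
    have := i.hom_inv_id
    rw [h, h'] at this
    exact TotalBicat.heq this
  inv_hom := by
    have := i.inv_hom_id
    rw [h, h'] at this
    exact TotalBicat.heq this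

/-- The vertical composite of displayed invertible 2-cells. -/
def DispIso.trans {a b : B} {f g h : a ⟶ b} {e : f ≅ g} {e' : g ≅ h}
    {x : D.Obj a} {y : D.Obj b} {ff : D.Hom f x y} {gg : D.Hom g x y} {hh : D.Hom h x y}
    (ee : DispIso D.toDispBicatData e ff gg) (ee' : DispIso D.toDispBicatData e' gg hh) :
    DispIso D.toDispBicatData (e ≪≫ e') ff hh :=
  DispIso.ofTotal (x := ⟨a, x⟩) (y := ⟨b, y⟩) (f := TotalBicat.mkHom f ff)
    (g := TotalBicat.mkHom h hh) (e ≪≫ e')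
    (TotalBicat.mkIso (g := TotalBicat.mkHom g gg) e ee ≪≫ TotalBicat.mkIso e' ee')
    (D.comp₂ ee.hom ee'.hom) (D.comp₂ ee'.inv ee.inv) rfl rfl

/-- The image of a displayed invertible 2-cell under a displayed pseudofunctor. -/
def DispPseudofunctor.mapIso {F : B ⥤ᵖ C} (FF : DispPseudofunctor F D E)
    {a b : B} {f g : a ⟶ b} {e : f ≅ g} {x : D.Obj a} {y : D.Obj b}
    {ff : D.Hom f x y} {gg : D.Hom g x y} (ee : DispIso D.toDispBicatData e ff gg) :
    DispIso E.toDispBicatData (F.map₂Iso e) (FF.map ff) (FF.map gg) :=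
  DispIso.ofTotal (x := ⟨F.obj a, FF.obj x⟩) (y := ⟨F.obj b, FF.obj y⟩)
    (f := TotalBicat.mkHom (F.map f) (FF.map ff))
    (g := TotalBicat.mkHom (F.map g) (FF.map gg)) (F.map₂Iso e)
    (FF.total.map₂Iso (TotalBicat.mkIso (x := ⟨a, x⟩) (y := ⟨b, y⟩)
      (f := TotalBicat.mkHom f ff) (g := TotalBicat.mkHom g gg) e ee))
    (FF.map₂ ee.hom) (FF.map₂ ee.inv) rfl rfl

/-- The identity displayed pseudofunctor. -/
def DispPseudofunctor.id (D : DispBicat.{w₁, v₁, u₁, w₁', v₁', u₁'} B) :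
    DispPseudofunctor (Pseudofunctor.id B) D D where
  obj x := x
  map ff := ff
  map₂ θθ := θθ
  mapId x := DispIso.refl (D.id₁ x)
  mapComp ff gg := DispIso.refl (D.comp₁ ff gg)
  map₂_id _ := HEq.rfl
  map₂_comp _ _ := HEq.rfl
  map₂_whiskerLeft {_ _ _ f _ _ _ x y z} ff gg hh θθ :=
    TotalBicat.heq ((Pseudofunctor.id (TotalBicat D)).map₂_whisker_left
      (a := ⟨_, x⟩) (b := ⟨_, y⟩) (c := ⟨_, z⟩) (TotalBicat.mkHom f ff)
      (g := TotalBicat.mkHom _ gg) (h := TotalBicat.mkHom _ hh) (TotalBicat.mkHom₂ _ θθ))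
  map₂_whiskerRight {_ _ _ _ _ h _ x y z ff gg} θθ hh :=
    TotalBicat.heq ((Pseudofunctor.id (TotalBicat D)).map₂_whisker_right
      (a := ⟨_, x⟩) (b := ⟨_, y⟩) (c := ⟨_, z⟩)
      (f := TotalBicat.mkHom _ ff) (g := TotalBicat.mkHom _ gg) (TotalBicat.mkHom₂ _ θθ)
      (TotalBicat.mkHom h hh))
  map₂_associator {_ _ _ _ _ _ _ x y z t} ff gg hh :=
    TotalBicat.heq ((Pseudofunctor.id (TotalBicat D)).map₂_associator
      (a := ⟨_, x⟩) (b := ⟨_, y⟩) (c := ⟨_, z⟩) (d := ⟨_, t⟩)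
      (TotalBicat.mkHom _ ff) (TotalBicat.mkHom _ gg) (TotalBicat.mkHom _ hh))
  map₂_leftUnitor {_ _ _ x y} ff :=
    TotalBicat.heq ((Pseudofunctor.id (TotalBicat D)).map₂_left_unitor
      (a := ⟨_, x⟩) (b := ⟨_, y⟩) (TotalBicat.mkHom _ ff))
  map₂_rightUnitor {_ _ _ x y} ff :=
    TotalBicat.heq ((Pseudofunctor.id (TotalBicat D)).map₂_right_unitor
      (a := ⟨_, x⟩) (b := ⟨_, y⟩) (TotalBicat.mkHom _ ff))

/-- The composite of displayed pseudofunctors. -/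
def DispPseudofunctor.comp {F : B ⥤ᵖ C} {G : C ⥤ᵖ A} (FF : DispPseudofunctor F D E)
    (GG : DispPseudofunctor G E K) : DispPseudofunctor (F.comp G) D K where
  obj x := GG.obj (FF.obj x)
  map ff := GG.map (FF.map ff)
  map₂ θθ := GG.map₂ (FF.map₂ θθ)
  mapId x := (GG.mapIso (FF.mapId x)).trans (GG.mapId (FF.obj x))
  mapComp ff gg := (GG.mapIso (FF.mapComp ff gg)).trans (GG.mapComp (FF.map ff) (FF.map gg))
  map₂_id {_ _ _ x y} ff :=
    TotalBicat.heq ((FF.total.comp GG.total).map₂_id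
      (a := ⟨_, x⟩) (b := ⟨_, y⟩) (TotalBicat.mkHom _ ff))
  map₂_comp {_ _ _ _ _ _ _ x y ff gg hh} θθ γγ :=
    TotalBicat.heq ((FF.total.comp GG.total).map₂_comp
      (a := ⟨_, x⟩) (b := ⟨_, y⟩) (f := TotalBicat.mkHom _ ff) (g := TotalBicat.mkHom _ gg)
      (h := TotalBicat.mkHom _ hh) (TotalBicat.mkHom₂ _ θθ) (TotalBicat.mkHom₂ _ γγ))
  map₂_whiskerLeft {_ _ _ f _ _ _ x y z} ff gg hh θθ :=
    TotalBicat.heq ((FF.total.comp GG.total).map₂_whisker_left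
      (a := ⟨_, x⟩) (b := ⟨_, y⟩) (c := ⟨_, z⟩) (TotalBicat.mkHom f ff)
      (g := TotalBicat.mkHom _ gg) (h := TotalBicat.mkHom _ hh) (TotalBicat.mkHom₂ _ θθ))
  map₂_whiskerRight {_ _ _ _ _ h _ x y z ff gg} θθ hh :=
    TotalBicat.heq ((FF.total.comp GG.total).map₂_whisker_right
      (a := ⟨_, x⟩) (b := ⟨_, y⟩) (c := ⟨_, z⟩)
      (f := TotalBicat.mkHom _ ff) (g := TotalBicat.mkHom _ gg) (TotalBicat.mkHom₂ _ θθ)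
      (TotalBicat.mkHom h hh))
  map₂_associator {_ _ _ _ _ _ _ x y z t} ff gg hh :=
    TotalBicat.heq ((FF.total.comp GG.total).map₂_associator
      (a := ⟨_, x⟩) (b := ⟨_, y⟩) (c := ⟨_, z⟩) (d := ⟨_, t⟩)
      (TotalBicat.mkHom _ ff) (TotalBicat.mkHom _ gg) (TotalBicat.mkHom _ hh))
  map₂_leftUnitor {_ _ _ x y} ff :=
    TotalBicat.heq ((FF.total.comp GG.total).map₂_left_unitor
      (a := ⟨_, x⟩) (b := ⟨_, y⟩) (TotalBicat.mkHom _ ff))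
  map₂_rightUnitor {_ _ _ x y} ff :=
    TotalBicat.heq ((FF.total.comp GG.total).map₂_right_unitor
      (a := ⟨_, x⟩) (b := ⟨_, y⟩) (TotalBicat.mkHom _ ff))

theorem DispPseudofunctor.total_id :
    (DispPseudofunctor.id D).total = Pseudofunctor.id (TotalBicat D) := rfl

theorem DispPseudofunctor.total_comp {F : B ⥤ᵖ C} {G : C ⥤ᵖ A} (FF : DispPseudofunctor F D E)
    (GG : DispPseudofunctor G E K) : (FF.comp GG).total = FF.total.comp GG.total := rfl

end DispPseudofunctor

/-! ## Displayed pseudotransformations and displayed invertible modifications -/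

section DispStrongTrans

variable {B : Type u₁} [Bicategory.{w₁, v₁} B] {C : Type u₂} [Bicategory.{w₂, v₂} C]
  {D : DispBicat.{w₁, v₁, u₁, w₁', v₁', u₁'} B} {E : DispBicat.{w₂, v₂, u₂, w₂', v₂', u₂'} C}
  {F G H : B ⥤ᵖ C}

/-- Left whiskering of a displayed invertible 2-cell. -/
def DispIso.whiskerLeft {a b c : B} {f : a ⟶ b} {g h : b ⟶ c} {e : g ≅ h}
    {x : D.Obj a} {y : D.Obj b} {z : D.Obj c} (ff : D.Hom f x y)
    {gg : D.Hom g y z} {hh : D.Hom h y z} (ee : DispIso D.toDispBicatData e gg hh) :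
    DispIso D.toDispBicatData (whiskerLeftIso f e) (D.comp₁ ff gg) (D.comp₁ ff hh) :=
  DispIso.ofTotal (x := ⟨a, x⟩) (y := ⟨c, z⟩) (f := TotalBicat.mkHom (f ≫ g) (D.comp₁ ff gg))
    (g := TotalBicat.mkHom (f ≫ h) (D.comp₁ ff hh)) (whiskerLeftIso f e)
    (whiskerLeftIso (TotalBicat.mkHom (x := ⟨a, x⟩) (y := ⟨b, y⟩) f ff)
      (TotalBicat.mkIso (x := ⟨b, y⟩) (y := ⟨c, z⟩) (f := TotalBicat.mkHom g gg)
        (g := TotalBicat.mkHom h hh) e ee))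
    (D.whiskerLeft ff ee.hom) (D.whiskerLeft ff ee.inv) rfl rfl

/-- Right whiskering of a displayed invertible 2-cell. -/
def DispIso.whiskerRight {a b c : B} {f g : a ⟶ b} {h : b ⟶ c} {e : f ≅ g}
    {x : D.Obj a} {y : D.Obj b} {z : D.Obj c} {ff : D.Hom f x y} {gg : D.Hom g x y}
    (ee : DispIso D.toDispBicatData e ff gg) (hh : D.Hom h y z) :
    DispIso D.toDispBicatData (whiskerRightIso e h) (D.comp₁ ff hh) (D.comp₁ gg hh) :=
  DispIso.ofTotal (x := ⟨a, x⟩) (y := ⟨c, z⟩) (f := TotalBicat.mkHom (f ≫ h) (D.comp₁ ff hh))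
    (g := TotalBicat.mkHom (g ≫ h) (D.comp₁ gg hh)) (whiskerRightIso e h)
    (whiskerRightIso (TotalBicat.mkIso (x := ⟨a, x⟩) (y := ⟨b, y⟩) (f := TotalBicat.mkHom f ff)
        (g := TotalBicat.mkHom g gg) e ee)
      (TotalBicat.mkHom (x := ⟨b, y⟩) (y := ⟨c, z⟩) h hh))
    (D.whiskerRight ee.hom hh) (D.whiskerRight ee.inv hh) rfl rfl

/-- A displayed pseudotransformation over `η`: the data and the laws are those of
`CategoryTheory.Pseudofunctor.StrongTrans`, each lying over the corresponding one of `η`. -/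
structure DispStrongTrans (η : F ⟶ G) (FF : DispPseudofunctor F D E)
    (GG : DispPseudofunctor G D E) where
  app {a : B} (x : D.Obj a) : E.Hom (η.app a) (FF.obj x) (GG.obj x)
  naturality {a b : B} {f : a ⟶ b} {x : D.Obj a} {y : D.Obj b} (ff : D.Hom f x y) :
    DispIso E.toDispBicatData (η.naturality f)
      (E.comp₁ (FF.map ff) (app y)) (E.comp₁ (app x) (GG.map ff))
  naturality_naturality {a b : B} {f g : a ⟶ b} {θ : f ⟶ g} {x : D.Obj a} {y : D.Obj b}
    {ff : D.Hom f x y} {gg : D.Hom g x y} (θθ : D.Hom₂ θ ff gg) :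
    HEq (E.comp₂ (E.whiskerRight (FF.map₂ θθ) (app y)) (naturality gg).hom)
      (E.comp₂ (naturality ff).hom (E.whiskerLeft (app x) (GG.map₂ θθ)))
  naturality_id {a : B} (x : D.Obj a) :
    HEq (E.comp₂ (naturality (D.id₁ x)).hom (E.whiskerLeft (app x) (GG.mapId x).hom))
      (E.comp₂ (E.whiskerRight (FF.mapId x).hom (app x))
        (E.comp₂ (E.leftUnitor (app x)).hom (E.rightUnitor (app x)).inv))
  naturality_comp {a b c : B} {f : a ⟶ b} {g : b ⟶ c} {x : D.Obj a} {y : D.Obj b} {z : D.Obj c}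
    (ff : D.Hom f x y) (gg : D.Hom g y z) :
    HEq (E.comp₂ (naturality (D.comp₁ ff gg)).hom
        (E.whiskerLeft (app x) (GG.mapComp ff gg).hom))
      (E.comp₂ (E.whiskerRight (FF.mapComp ff gg).hom (app z))
        (E.comp₂ (E.associator (FF.map ff) (FF.map gg) (app z)).hom
          (E.comp₂ (E.whiskerLeft (FF.map ff) (naturality gg).hom)
            (E.comp₂ (E.associator (FF.map ff) (app y) (GG.map gg)).inv
              (E.comp₂ (E.whiskerRight (naturality ff).hom (GG.map gg))
                (E.associator (app x) (GG.map ff) (GG.map gg)).hom)))))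

/-- The total pseudotransformation of a displayed pseudotransformation. -/
def DispStrongTrans.total {η : F ⟶ G} {FF : DispPseudofunctor F D E}
    {GG : DispPseudofunctor G D E} (ηη : DispStrongTrans η FF GG) : FF.total ⟶ GG.total :=
  { app := fun x => TotalBicat.mkHom (η.app x.base) (ηη.app x.disp)
    naturality := fun f => TotalBicat.mkIso (η.naturality f.base) (ηη.naturality f.disp)
    naturality_naturality := fun θ =>
      TotalBicat.ext₂ (η.naturality_naturality θ.base) (ηη.naturality_naturality θ.disp)
    naturality_id := fun x =>
      TotalBicat.ext₂ (η.naturality_id x.base) (ηη.naturality_id x.disp)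
    naturality_comp := fun f g =>
      TotalBicat.ext₂ (η.naturality_comp f.base g.base) (ηη.naturality_comp f.disp g.disp) }

/-- The identity displayed pseudotransformation. -/
def DispStrongTrans.id (FF : DispPseudofunctor F D E) : DispStrongTrans (𝟙 F) FF FF where
  app x := E.id₁ (FF.obj x)
  naturality ff := (E.rightUnitor (FF.map ff)).trans (E.leftUnitor (FF.map ff)).symm
  naturality_naturality {_ _ _ _ _ x y ff gg} θθ :=
    TotalBicat.heq (Pseudofunctor.StrongTrans.naturality_naturality (𝟙 FF.total)
      (a := ⟨_, x⟩) (b := ⟨_, y⟩) (f := TotalBicat.mkHom _ ff) (g := TotalBicat.mkHom _ gg)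
      (TotalBicat.mkHom₂ _ θθ))
  naturality_id x :=
    TotalBicat.heq (Pseudofunctor.StrongTrans.naturality_id (𝟙 FF.total) ⟨_, x⟩)
  naturality_comp {_ _ _ _ _ x y z} ff gg :=
    TotalBicat.heq (Pseudofunctor.StrongTrans.naturality_comp (𝟙 FF.total)
      (a := ⟨_, x⟩) (b := ⟨_, y⟩) (c := ⟨_, z⟩) (TotalBicat.mkHom _ ff) (TotalBicat.mkHom _ gg))

/-- The vertical composite of displayed pseudotransformations. -/
def DispStrongTrans.comp {η : F ⟶ G} {θ : G ⟶ H} {FF : DispPseudofunctor F D E}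
    {GG : DispPseudofunctor G D E} {HH : DispPseudofunctor H D E}
    (ηη : DispStrongTrans η FF GG) (θθ : DispStrongTrans θ GG HH) :
    DispStrongTrans (η ≫ θ) FF HH where
  app x := E.comp₁ (ηη.app x) (θθ.app x)
  naturality {_ _ _ x y} ff :=
    (E.associator (FF.map ff) (ηη.app y) (θθ.app y)).symm.trans
      (((ηη.naturality ff).whiskerRight (θθ.app y)).trans
        ((E.associator (ηη.app x) (GG.map ff) (θθ.app y)).trans
          ((DispIso.whiskerLeft (ηη.app x) (θθ.naturality ff)).trans
            (E.associator (ηη.app x) (θθ.app x) (HH.map ff)).symm)))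
  naturality_naturality {_ _ _ _ _ x y ff gg} γγ :=
    TotalBicat.heq (Pseudofunctor.StrongTrans.naturality_naturality (ηη.total ≫ θθ.total)
      (a := ⟨_, x⟩) (b := ⟨_, y⟩) (f := TotalBicat.mkHom _ ff) (g := TotalBicat.mkHom _ gg)
      (TotalBicat.mkHom₂ _ γγ))
  naturality_id x :=
    TotalBicat.heq (Pseudofunctor.StrongTrans.naturality_id (ηη.total ≫ θθ.total) ⟨_, x⟩)
  naturality_comp {_ _ _ _ _ x y z} ff gg :=
    TotalBicat.heq (Pseudofunctor.StrongTrans.naturality_comp (ηη.total ≫ θθ.total)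
      (a := ⟨_, x⟩) (b := ⟨_, y⟩) (c := ⟨_, z⟩) (TotalBicat.mkHom _ ff) (TotalBicat.mkHom _ gg))

theorem DispStrongTrans.total_id (FF : DispPseudofunctor F D E) :
    (DispStrongTrans.id FF).total = 𝟙 FF.total := rfl

theorem DispStrongTrans.total_comp {η : F ⟶ G} {θ : G ⟶ H} {FF : DispPseudofunctor F D E}
    {GG : DispPseudofunctor G D E} {HH : DispPseudofunctor H D E}
    (ηη : DispStrongTrans η FF GG) (θθ : DispStrongTrans θ GG HH) :
    (ηη.comp θθ).total = ηη.total ≫ θθ.total := rfl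

/-- The invertible 2-cells of an invertible modification. -/
def invModificationApp {η θ : F ⟶ G} (m : η ≅ θ) (a : B) : η.app a ≅ θ.app a where
  hom := m.hom.as.app a
  inv := m.inv.as.app a
  hom_inv_id := congrArg (fun k : η ⟶ η => k.as.app a) m.hom_inv_id
  inv_hom_id := congrArg (fun k : θ ⟶ θ => k.as.app a) m.inv_hom_id

/-- A displayed invertible modification over an invertible modification `m`. -/
structure DispInvModification {η θ : F ⟶ G} (m : η ≅ θ) {FF : DispPseudofunctor F D E}
    {GG : DispPseudofunctor G D E} (ηη : DispStrongTrans η FF GG)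
    (θθ : DispStrongTrans θ FF GG) where
  app {a : B} (x : D.Obj a) :
    DispIso E.toDispBicatData (invModificationApp m a) (ηη.app x) (θθ.app x)
  naturality {a b : B} {f : a ⟶ b} {x : D.Obj a} {y : D.Obj b} (ff : D.Hom f x y) :
    HEq (E.comp₂ (E.whiskerLeft (FF.map ff) (app y).hom) (θθ.naturality ff).hom)
      (E.comp₂ (ηη.naturality ff).hom (E.whiskerRight (app x).hom (GG.map ff)))

/-- The total invertible modification of a displayed invertible modification. -/
def DispInvModification.total {η θ : F ⟶ G} {m : η ≅ θ} {FF : DispPseudofunctor F D E}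
    {GG : DispPseudofunctor G D E} {ηη : DispStrongTrans η FF GG} {θθ : DispStrongTrans θ FF GG}
    (mm : DispInvModification m ηη θθ) : ηη.total ≅ θθ.total :=
  Pseudofunctor.StrongTrans.isoMk
    (fun x => TotalBicat.mkIso (invModificationApp m x.base) (mm.app x.disp))
    (fun f => TotalBicat.ext₂ (m.hom.as.naturality f.base) (mm.naturality f.disp))

end DispStrongTrans

/-! ## Biequivalences and displayed biequivalences -/

section Biequivalence

variable {B : Type u₁} [Bicategory.{w₁, v₁} B] {C : Type u₂} [Bicategory.{w₂, v₂} C]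

/-- A biequivalence from `B` to `C`. -/
structure Biequivalence (B : Type u₁) [Bicategory.{w₁, v₁} B]
    (C : Type u₂) [Bicategory.{w₂, v₂} C] where
  L : B ⥤ᵖ C
  R : C ⥤ᵖ B
  unit : R.comp L ⟶ Pseudofunctor.id C
  unitInv : Pseudofunctor.id C ⟶ R.comp L
  counit : L.comp R ⟶ Pseudofunctor.id B
  counitInv : Pseudofunctor.id B ⟶ L.comp R
  m₁ : unit ≫ unitInv ≅ 𝟙 (R.comp L)
  m₂ : unitInv ≫ unit ≅ 𝟙 (Pseudofunctor.id C)
  m₃ : counit ≫ counitInv ≅ 𝟙 (L.comp R)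
  m₄ : counitInv ≫ counit ≅ 𝟙 (Pseudofunctor.id B)

/-- A displayed biequivalence over a biequivalence `e`. -/
structure DispBiequivalence (e : Biequivalence B C)
    (D : DispBicat.{w₁, v₁, u₁, w₁', v₁', u₁'} B)
    (E : DispBicat.{w₂, v₂, u₂, w₂', v₂', u₂'} C) where
  L : DispPseudofunctor e.L D E
  R : DispPseudofunctor e.R E D
  unit : DispStrongTrans e.unit (R.comp L) (DispPseudofunctor.id E)
  unitInv : DispStrongTrans e.unitInv (DispPseudofunctor.id E) (R.comp L)
  counit : DispStrongTrans e.counit (L.comp R) (DispPseudofunctor.id D)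
  counitInv : DispStrongTrans e.counitInv (DispPseudofunctor.id D) (L.comp R)
  m₁ : DispInvModification e.m₁ (unit.comp unitInv) (DispStrongTrans.id (R.comp L))
  m₂ : DispInvModification e.m₂ (unitInv.comp unit) (DispStrongTrans.id (DispPseudofunctor.id E))
  m₃ : DispInvModification e.m₃ (counit.comp counitInv) (DispStrongTrans.id (L.comp R))
  m₄ : DispInvModification e.m₄ (counitInv.comp counit) (DispStrongTrans.id (DispPseudofunctor.id D))

/-- The total biequivalence of a displayed biequivalence. -/
def DispBiequivalence.total {e : Biequivalence B C}
    {D : DispBicat.{w₁, v₁, u₁, w₁', v₁', u₁'} B} {E : DispBicat.{w₂, v₂, u₂, w₂', v₂', u₂'} C}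
    (ee : DispBiequivalence e D E) : Biequivalence (TotalBicat D) (TotalBicat E) where
  L := ee.L.total
  R := ee.R.total
  unit := ee.unit.total
  unitInv := ee.unitInv.total
  counit := ee.counit.total
  counitInv := ee.counitInv.total
  m₁ := ee.m₁.total
  m₂ := ee.m₂.total
  m₃ := ee.m₃.total
  m₄ := ee.m₄.total

/-- The canonical pseudotransformation from `id · id` to `id`. -/
def idCompIdHom (B : Type u₁) [Bicategory.{w₁, v₁} B] :
    (Pseudofunctor.id B).comp (Pseudofunctor.id B) ⟶ Pseudofunctor.id B :=
  { app := fun a => 𝟙 a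
    naturality := fun f => ρ_ f ≪≫ (λ_ f).symm
    naturality_naturality := fun {a b f g} θ => by
      change θ ▷ 𝟙 b ≫ (ρ_ g).hom ≫ (λ_ g).inv = ((ρ_ f).hom ≫ (λ_ f).inv) ≫ 𝟙 a ◁ θ
      simp
    naturality_id := fun a => by
      change ((ρ_ (𝟙 a)).hom ≫ (λ_ (𝟙 a)).inv) ≫ 𝟙 a ◁ 𝟙 (𝟙 a) =
        (𝟙 (𝟙 a) ≫ 𝟙 (𝟙 a)) ▷ 𝟙 a ≫ (λ_ (𝟙 a)).hom ≫ (ρ_ (𝟙 a)).inv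
      simp [unitors_equal, unitors_inv_equal]
    naturality_comp := fun {a b c} f g => by
      change ((ρ_ (f ≫ g)).hom ≫ (λ_ (f ≫ g)).inv) ≫ 𝟙 a ◁ 𝟙 (f ≫ g) =
        (𝟙 (f ≫ g) ≫ 𝟙 (f ≫ g)) ▷ 𝟙 c ≫ (α_ f g (𝟙 c)).hom ≫
          f ◁ ((ρ_ g).hom ≫ (λ_ g).inv) ≫ (α_ f (𝟙 b) g).inv ≫
            ((ρ_ f).hom ≫ (λ_ f).inv) ▷ g ≫ (α_ (𝟙 a) f g).hom
      simp }

/-- The canonical pseudotransformation from `id` to `id · id`. -/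
def idCompIdInv (B : Type u₁) [Bicategory.{w₁, v₁} B] :
    Pseudofunctor.id B ⟶ (Pseudofunctor.id B).comp (Pseudofunctor.id B) :=
  { app := fun a => 𝟙 a
    naturality := fun f => ρ_ f ≪≫ (λ_ f).symm
    naturality_naturality := (idCompIdHom B).naturality_naturality
    naturality_id := fun a => by
      change ((ρ_ (𝟙 a)).hom ≫ (λ_ (𝟙 a)).inv) ≫ 𝟙 a ◁ (𝟙 (𝟙 a) ≫ 𝟙 (𝟙 a)) =
        𝟙 (𝟙 a) ▷ 𝟙 a ≫ (λ_ (𝟙 a)).hom ≫ (ρ_ (𝟙 a)).inv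
      simp [unitors_equal, unitors_inv_equal]
    naturality_comp := fun {a b c} f g => by
      change ((ρ_ (f ≫ g)).hom ≫ (λ_ (f ≫ g)).inv) ≫ 𝟙 a ◁ (𝟙 (f ≫ g) ≫ 𝟙 (f ≫ g)) =
        𝟙 (f ≫ g) ▷ 𝟙 c ≫ (α_ f g (𝟙 c)).hom ≫
          f ◁ ((ρ_ g).hom ≫ (λ_ g).inv) ≫ (α_ f (𝟙 b) g).inv ≫
            ((ρ_ f).hom ≫ (λ_ f).inv) ▷ g ≫ (α_ (𝟙 a) f g).hom
      simp }

/-- The family of left unitors of identities satisfies the modification law. -/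
theorem id_modification_law {a b : B} (f : a ⟶ b) :
    f ◁ (λ_ (𝟙 b)).hom ≫ (ρ_ f).hom ≫ (λ_ f).inv =
      ((α_ f (𝟙 b) (𝟙 b)).inv ≫ ((ρ_ f).hom ≫ (λ_ f).inv) ▷ 𝟙 b ≫ (α_ (𝟙 a) f (𝟙 b)).hom ≫
        𝟙 a ◁ ((ρ_ f).hom ≫ (λ_ f).inv) ≫ (α_ (𝟙 a) (𝟙 a) f).inv) ≫ (λ_ (𝟙 a)).hom ▷ f := by
  simp [unitors_equal]

/-- The identity biequivalence. -/
def Biequivalence.refl (B : Type u₁) [Bicategory.{w₁, v₁} B] : Biequivalence B B where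
  L := Pseudofunctor.id B
  R := Pseudofunctor.id B
  unit := idCompIdHom B
  unitInv := idCompIdInv B
  counit := idCompIdHom B
  counitInv := idCompIdInv B
  m₁ := Pseudofunctor.StrongTrans.isoMk (fun a => λ_ (𝟙 a)) id_modification_law
  m₂ := Pseudofunctor.StrongTrans.isoMk (fun a => λ_ (𝟙 a)) id_modification_law
  m₃ := Pseudofunctor.StrongTrans.isoMk (fun a => λ_ (𝟙 a)) id_modification_law
  m₄ := Pseudofunctor.StrongTrans.isoMk (fun a => λ_ (𝟙 a)) id_modification_law

end Biequivalence

/-! ## Locally propositional displayed bicategories -/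

section LocallyProp

variable {B : Type u₁} [Bicategory.{w₁, v₁} B]

theorem DispBicatData.heq_of_prop (D : DispBicatData.{w₁, v₁, u₁, w₁', v₁', u₁'} B)
    (hD : ∀ {a b : B} {f g : a ⟶ b} (θ : f ⟶ g) {x : D.Obj a} {y : D.Obj b} (ff : D.Hom f x y)
      (gg : D.Hom g x y), Subsingleton (D.Hom₂ θ ff gg))
    {a b : B} {f g : a ⟶ b} {θ γ : f ⟶ g} {x : D.Obj a} {y : D.Obj b} {ff : D.Hom f x y}
    {gg : D.Hom g x y} (h : θ = γ) (p : D.Hom₂ θ ff gg) (q : D.Hom₂ γ ff gg) : HEq p q := by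
  subst h
  exact heq_of_eq ((hD θ ff gg).elim p q)

/-- If there is at most one displayed 2-cell over any 2-cell with given ends, then the laws of a
displayed bicategory hold automatically. -/
abbrev DispBicat.ofProp (D : DispBicatData.{w₁, v₁, u₁, w₁', v₁', u₁'} B)
    (hD : ∀ {a b : B} {f g : a ⟶ b} (θ : f ⟶ g) {x : D.Obj a} {y : D.Obj b} (ff : D.Hom f x y)
      (gg : D.Hom g x y), Subsingleton (D.Hom₂ θ ff gg))
    (whiskerLeft : ∀ {a b c : B} {f : a ⟶ b} {g h : b ⟶ c} {θ : g ⟶ h}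
      {x : D.Obj a} {y : D.Obj b} {z : D.Obj c} (ff : D.Hom f x y) {gg : D.Hom g y z}
      {hh : D.Hom h y z}, D.Hom₂ θ gg hh → D.Hom₂ (f ◁ θ) (D.comp₁ ff gg) (D.comp₁ ff hh))
    (whiskerRight : ∀ {a b c : B} {f g : a ⟶ b} {θ : f ⟶ g} {h : b ⟶ c}
      {x : D.Obj a} {y : D.Obj b} {z : D.Obj c} {ff : D.Hom f x y} {gg : D.Hom g x y},
      D.Hom₂ θ ff gg → ∀ hh : D.Hom h y z, D.Hom₂ (θ ▷ h) (D.comp₁ ff hh) (D.comp₁ gg hh))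
    (associator : ∀ {a b c d : B} {f : a ⟶ b} {g : b ⟶ c} {h : c ⟶ d}
      {x : D.Obj a} {y : D.Obj b} {z : D.Obj c} {t : D.Obj d}
      (ff : D.Hom f x y) (gg : D.Hom g y z) (hh : D.Hom h z t),
      D.Hom₂ (α_ f g h).hom (D.comp₁ (D.comp₁ ff gg) hh) (D.comp₁ ff (D.comp₁ gg hh)))
    (associatorInv : ∀ {a b c d : B} {f : a ⟶ b} {g : b ⟶ c} {h : c ⟶ d}
      {x : D.Obj a} {y : D.Obj b} {z : D.Obj c} {t : D.Obj d}
      (ff : D.Hom f x y) (gg : D.Hom g y z) (hh : D.Hom h z t),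
      D.Hom₂ (α_ f g h).inv (D.comp₁ ff (D.comp₁ gg hh)) (D.comp₁ (D.comp₁ ff gg) hh))
    (leftUnitor : ∀ {a b : B} {f : a ⟶ b} {x : D.Obj a} {y : D.Obj b} (ff : D.Hom f x y),
      D.Hom₂ (λ_ f).hom (D.comp₁ (D.id₁ x) ff) ff)
    (leftUnitorInv : ∀ {a b : B} {f : a ⟶ b} {x : D.Obj a} {y : D.Obj b} (ff : D.Hom f x y),
      D.Hom₂ (λ_ f).inv ff (D.comp₁ (D.id₁ x) ff))
    (rightUnitor : ∀ {a b : B} {f : a ⟶ b} {x : D.Obj a} {y : D.Obj b} (ff : D.Hom f x y),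
      D.Hom₂ (ρ_ f).hom (D.comp₁ ff (D.id₁ y)) ff)
    (rightUnitorInv : ∀ {a b : B} {f : a ⟶ b} {x : D.Obj a} {y : D.Obj b} (ff : D.Hom f x y),
      D.Hom₂ (ρ_ f).inv ff (D.comp₁ ff (D.id₁ y))) :
    DispBicat.{w₁, v₁, u₁, w₁', v₁', u₁'} B where
  toDispBicatData := D
  whiskerLeft ff _ _ θθ := whiskerLeft ff θθ
  whiskerRight θθ hh := whiskerRight θθ hh
  associator ff gg hh :=
    { hom := associator ff gg hh
      inv := associatorInv ff gg hh
      hom_inv := D.heq_of_prop hD (Iso.hom_inv_id _) _ _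
      inv_hom := D.heq_of_prop hD (Iso.inv_hom_id _) _ _ }
  leftUnitor ff :=
    { hom := leftUnitor ff
      inv := leftUnitorInv ff
      hom_inv := D.heq_of_prop hD (Iso.hom_inv_id _) _ _
      inv_hom := D.heq_of_prop hD (Iso.inv_hom_id _) _ _ }
  rightUnitor ff :=
    { hom := rightUnitor ff
      inv := rightUnitorInv ff
      hom_inv := D.heq_of_prop hD (Iso.hom_inv_id _) _ _
      inv_hom := D.heq_of_prop hD (Iso.inv_hom_id _) _ _ }
  id_comp _ := D.heq_of_prop hD (Category.id_comp _) _ _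
  comp_id _ := D.heq_of_prop hD (Category.comp_id _) _ _
  assoc _ _ _ := D.heq_of_prop hD (Category.assoc _ _ _) _ _
  whiskerLeft_id _ _ := D.heq_of_prop hD (Bicategory.whiskerLeft_id _ _) _ _
  whiskerLeft_comp _ _ _ _ _ _ := D.heq_of_prop hD (Bicategory.whiskerLeft_comp _ _ _) _ _
  id_whiskerLeft _ := D.heq_of_prop hD (Bicategory.id_whiskerLeft _) _ _
  comp_whiskerLeft _ _ _ _ _ := D.heq_of_prop hD (Bicategory.comp_whiskerLeft _ _ _) _ _
  id_whiskerRight _ _ := D.heq_of_prop hD (Bicategory.id_whiskerRight _ _) _ _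
  comp_whiskerRight _ _ _ := D.heq_of_prop hD (Bicategory.comp_whiskerRight _ _ _) _ _
  whiskerRight_id _ := D.heq_of_prop hD (Bicategory.whiskerRight_id _) _ _
  whiskerRight_comp _ _ _ := D.heq_of_prop hD (Bicategory.whiskerRight_comp _ _ _) _ _
  whisker_assoc _ _ _ _ _ := D.heq_of_prop hD (Bicategory.whisker_assoc _ _ _) _ _
  whisker_exchange _ _ := D.heq_of_prop hD (Bicategory.whisker_exchange _ _) _ _
  pentagon _ _ _ _ := D.heq_of_prop hD (Bicategory.pentagon _ _ _ _) _ _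
  triangle _ _ := D.heq_of_prop hD (Bicategory.triangle _ _) _ _

end LocallyProp

/-! ## Monads internal to a bicategory -/

section Monads

variable {B : Type u₁} [Bicategory.{w₁, v₁} B]

/-- A monad structure on the object `a` of a bicategory. -/
structure MonadStr (a : B) where
  m : a ⟶ a
  unit : 𝟙 a ⟶ m
  mul : m ≫ m ⟶ m
  unit_mul : unit ▷ m ≫ mul = (λ_ m).hom
  mul_unit : m ◁ unit ≫ mul = (ρ_ m).hom
  mul_assoc : m ◁ mul ≫ mul = (α_ m m m).inv ≫ mul ▷ m ≫ mul

/-- A displayed 1-cell between monad structures over `f`. -/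
structure MonadStr.Hom {a b : B} (f : a ⟶ b) (S : MonadStr a) (T : MonadStr b) where
  n : S.m ≫ f ≅ f ≫ T.m
  unit_law : S.unit ▷ f ≫ n.hom = (λ_ f).hom ≫ (ρ_ f).inv ≫ f ◁ T.unit
  mul_law : S.mul ▷ f ≫ n.hom =
    (α_ S.m S.m f).hom ≫ S.m ◁ n.hom ≫ (α_ S.m f T.m).inv ≫ n.hom ▷ T.m ≫
      (α_ f T.m T.m).hom ≫ f ◁ T.mul

theorem MonadStr.unit_comp_aux {a b c : B} {f : a ⟶ b} {g : b ⟶ c} {S : a ⟶ a} {T : b ⟶ b}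
    {U : c ⟶ c} {ηS : 𝟙 a ⟶ S} {ηT : 𝟙 b ⟶ T} {ηU : 𝟙 c ⟶ U}
    {p : S ≫ f ⟶ f ≫ T} {q : T ≫ g ⟶ g ≫ U}
    (hp : ηS ▷ f ≫ p = (λ_ f).hom ≫ (ρ_ f).inv ≫ f ◁ ηT)
    (hq : ηT ▷ g ≫ q = (λ_ g).hom ≫ (ρ_ g).inv ≫ g ◁ ηU) :
    ηS ▷ (f ≫ g) ≫ (α_ S f g).inv ≫ p ▷ g ≫ (α_ f T g).hom ≫ f ◁ q ≫ (α_ f g U).inv =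
      (λ_ (f ≫ g)).hom ≫ (ρ_ (f ≫ g)).inv ≫ (f ≫ g) ◁ ηU := by
  calc _ = 𝟙 _ ⊗≫ (ηS ▷ f ≫ p) ▷ g ⊗≫ f ◁ q ⊗≫ 𝟙 _ := by bicategory
    _ = 𝟙 _ ⊗≫ f ◁ (ηT ▷ g ≫ q) ⊗≫ 𝟙 _ := by rw [hp]; bicategory
    _ = _ := by rw [hq]; bicategory

theorem MonadStr.mul_comp_aux {a b c : B} {f : a ⟶ b} {g : b ⟶ c} {S : a ⟶ a} {T : b ⟶ b}
    {U : c ⟶ c} {μS : S ≫ S ⟶ S} {μT : T ≫ T ⟶ T} {μU : U ≫ U ⟶ U}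
    {p : S ≫ f ⟶ f ≫ T} {q : T ≫ g ⟶ g ≫ U}
    (hp : μS ▷ f ≫ p = (α_ S S f).hom ≫ S ◁ p ≫ (α_ S f T).inv ≫ p ▷ T ≫
      (α_ f T T).hom ≫ f ◁ μT)
    (hq : μT ▷ g ≫ q = (α_ T T g).hom ≫ T ◁ q ≫ (α_ T g U).inv ≫ q ▷ U ≫
      (α_ g U U).hom ≫ g ◁ μU) :
    μS ▷ (f ≫ g) ≫ (α_ S f g).inv ≫ p ▷ g ≫ (α_ f T g).hom ≫ f ◁ q ≫ (α_ f g U).inv =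
      (α_ S S (f ≫ g)).hom ≫
        S ◁ ((α_ S f g).inv ≫ p ▷ g ≫ (α_ f T g).hom ≫ f ◁ q ≫ (α_ f g U).inv) ≫
        (α_ S (f ≫ g) U).inv ≫
        ((α_ S f g).inv ≫ p ▷ g ≫ (α_ f T g).hom ≫ f ◁ q ≫ (α_ f g U).inv) ▷ U ≫
        (α_ (f ≫ g) U U).hom ≫ (f ≫ g) ◁ μU := by
  calc _ = 𝟙 _ ⊗≫ (μS ▷ f ≫ p) ▷ g ⊗≫ f ◁ q ⊗≫ 𝟙 _ := by bicategory
    _ = 𝟙 _ ⊗≫ S ◁ p ▷ g ⊗≫ p ▷ T ▷ g ⊗≫ f ◁ (μT ▷ g ≫ q) ⊗≫ 𝟙 _ := by rw [hp]; bicategory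
    _ = 𝟙 _ ⊗≫ S ◁ p ▷ g ⊗≫ (p ▷ (T ≫ g) ≫ (f ≫ T) ◁ q) ⊗≫ f ◁ q ▷ U ⊗≫ f ◁ g ◁ μU ⊗≫ 𝟙 _ := by
      rw [hq]; bicategory
    _ = _ := by rw [← whisker_exchange]; bicategory

/-- The identity displayed 1-cell. -/
def MonadStr.Hom.id {a : B} (S : MonadStr a) : MonadStr.Hom (𝟙 a) S S where
  n := ρ_ S.m ≪≫ (λ_ S.m).symm
  unit_law := by simp [unitors_equal]
  mul_law := by simp

/-- The composition of displayed 1-cells. -/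
def MonadStr.Hom.comp {a b c : B} {f : a ⟶ b} {g : b ⟶ c} {S : MonadStr a} {T : MonadStr b}
    {U : MonadStr c} (p : MonadStr.Hom f S T) (q : MonadStr.Hom g T U) :
    MonadStr.Hom (f ≫ g) S U where
  n := (α_ S.m f g).symm ≪≫ whiskerRightIso p.n g ≪≫ α_ f T.m g ≪≫ whiskerLeftIso f q.n ≪≫
    (α_ f g U.m).symm
  unit_law := MonadStr.unit_comp_aux p.unit_law q.unit_law
  mul_law := MonadStr.mul_comp_aux p.mul_law q.mul_law

/-- The displayed bicategory of monad structures: the displayed 2-cells over `θ` are proofs that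
`θ` commutes with the displayed 1-cells. -/
abbrev monadDispData (B : Type u₁) [Bicategory.{w₁, v₁} B] :
    DispBicatData.{w₁, v₁, u₁, 0, w₁, max v₁ w₁} B where
  Obj a := MonadStr a
  Hom f S T := MonadStr.Hom f S T
  Hom₂ {_ _ _ _} θ {S T} p q := PLift (S.m ◁ θ ≫ q.n.hom = p.n.hom ≫ θ ▷ T.m)
  id₁ S := MonadStr.Hom.id S
  comp₁ p q := p.comp q
  id₂ _ := ⟨by simp⟩
  comp₂ p q := ⟨by
    have hp := p.down
    have hq := q.down
    rw [Bicategory.whiskerLeft_comp, Category.assoc, hq, ← Category.assoc, hp, Category.assoc,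
      ← Bicategory.comp_whiskerRight]⟩

/-- The displayed bicategory of monads internal to `B`. -/
abbrev monadDisp (B : Type u₁) [Bicategory.{w₁, v₁} B] :
    DispBicat.{w₁, v₁, u₁, 0, w₁, max v₁ w₁} B :=
  DispBicat.ofProp (monadDispData B)
    (fun _ _ _ _ _ => ⟨fun h k => PLift.down_injective (Subsingleton.elim (PLift.down h) (PLift.down k))⟩)
    (fun {a b c f g h θ S T U} p q r k => PLift.up (by
      have hk := k.down
      change S.m ◁ f ◁ θ ≫ (α_ S.m f h).inv ≫ p.n.hom ▷ h ≫ (α_ f T.m h).hom ≫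
          f ◁ r.n.hom ≫ (α_ f h U.m).inv =
        ((α_ S.m f g).inv ≫ p.n.hom ▷ g ≫ (α_ f T.m g).hom ≫ f ◁ q.n.hom ≫ (α_ f g U.m).inv) ≫
          (f ◁ θ) ▷ U.m
      calc _ = 𝟙 _ ⊗≫ ((S.m ≫ f) ◁ θ ≫ p.n.hom ▷ h) ⊗≫ f ◁ r.n.hom ⊗≫ 𝟙 _ := by bicategory
        _ = 𝟙 _ ⊗≫ p.n.hom ▷ g ⊗≫ f ◁ (T.m ◁ θ ≫ r.n.hom) ⊗≫ 𝟙 _ := by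
          rw [whisker_exchange]; bicategory
        _ = _ := by rw [hk]; bicategory))
    (fun {a b c f g θ h S T U p q} k r => PLift.up (by
      have hk := k.down
      change S.m ◁ θ ▷ h ≫ (α_ S.m g h).inv ≫ q.n.hom ▷ h ≫ (α_ g T.m h).hom ≫
          g ◁ r.n.hom ≫ (α_ g h U.m).inv =
        ((α_ S.m f h).inv ≫ p.n.hom ▷ h ≫ (α_ f T.m h).hom ≫ f ◁ r.n.hom ≫ (α_ f h U.m).inv) ≫
          (θ ▷ h) ▷ U.m
      calc _ = 𝟙 _ ⊗≫ (S.m ◁ θ ≫ q.n.hom) ▷ h ⊗≫ g ◁ r.n.hom ⊗≫ 𝟙 _ := by bicategory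
        _ = 𝟙 _ ⊗≫ p.n.hom ▷ h ⊗≫ (θ ▷ (T.m ≫ h) ≫ g ◁ r.n.hom) ⊗≫ 𝟙 _ := by
          rw [hk]; bicategory
        _ = _ := by rw [← whisker_exchange]; bicategory))
    (fun {a b c d f g h S T U V} p q r => PLift.up (by
      change S.m ◁ (α_ f g h).hom ≫ (α_ S.m f (g ≫ h)).inv ≫ p.n.hom ▷ (g ≫ h) ≫
          (α_ f T.m (g ≫ h)).hom ≫ f ◁ ((α_ T.m g h).inv ≫ q.n.hom ▷ h ≫ (α_ g U.m h).hom ≫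
            g ◁ r.n.hom ≫ (α_ g h V.m).inv) ≫ (α_ f (g ≫ h) V.m).inv =
        ((α_ S.m (f ≫ g) h).inv ≫ ((α_ S.m f g).inv ≫ p.n.hom ▷ g ≫ (α_ f T.m g).hom ≫
            f ◁ q.n.hom ≫ (α_ f g U.m).inv) ▷ h ≫ (α_ (f ≫ g) U.m h).hom ≫
            (f ≫ g) ◁ r.n.hom ≫ (α_ (f ≫ g) h V.m).inv) ≫ (α_ f g h).hom ▷ V.m
      bicategory))
    (fun {a b c d f g h S T U V} p q r => PLift.up (by
      change S.m ◁ (α_ f g h).inv ≫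
          ((α_ S.m (f ≫ g) h).inv ≫ ((α_ S.m f g).inv ≫ p.n.hom ▷ g ≫ (α_ f T.m g).hom ≫
            f ◁ q.n.hom ≫ (α_ f g U.m).inv) ▷ h ≫ (α_ (f ≫ g) U.m h).hom ≫
            (f ≫ g) ◁ r.n.hom ≫ (α_ (f ≫ g) h V.m).inv) =
        ((α_ S.m f (g ≫ h)).inv ≫ p.n.hom ▷ (g ≫ h) ≫
          (α_ f T.m (g ≫ h)).hom ≫ f ◁ ((α_ T.m g h).inv ≫ q.n.hom ▷ h ≫ (α_ g U.m h).hom ≫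
            g ◁ r.n.hom ≫ (α_ g h V.m).inv) ≫ (α_ f (g ≫ h) V.m).inv) ≫ (α_ f g h).inv ▷ V.m
      bicategory))
    (fun {a b f S T} p => PLift.up (by
      change S.m ◁ (λ_ f).hom ≫ p.n.hom =
        ((α_ S.m (𝟙 a) f).inv ≫ ((ρ_ S.m).hom ≫ (λ_ S.m).inv) ▷ f ≫ (α_ (𝟙 a) S.m f).hom ≫
          𝟙 a ◁ p.n.hom ≫ (α_ (𝟙 a) f T.m).inv) ≫ (λ_ f).hom ▷ T.m
      bicategory))
    (fun {a b f S T} p => PLift.up (by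
      change S.m ◁ (λ_ f).inv ≫
        ((α_ S.m (𝟙 a) f).inv ≫ ((ρ_ S.m).hom ≫ (λ_ S.m).inv) ▷ f ≫ (α_ (𝟙 a) S.m f).hom ≫
          𝟙 a ◁ p.n.hom ≫ (α_ (𝟙 a) f T.m).inv) = p.n.hom ≫ (λ_ f).inv ▷ T.m
      bicategory))
    (fun {a b f S T} p => PLift.up (by
      change S.m ◁ (ρ_ f).hom ≫ p.n.hom =
        ((α_ S.m f (𝟙 b)).inv ≫ p.n.hom ▷ 𝟙 b ≫ (α_ f T.m (𝟙 b)).hom ≫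
          f ◁ ((ρ_ T.m).hom ≫ (λ_ T.m).inv) ≫ (α_ f (𝟙 b) T.m).inv) ≫ (ρ_ f).hom ▷ T.m
      bicategory))
    (fun {a b f S T} p => PLift.up (by
      change S.m ◁ (ρ_ f).inv ≫
        ((α_ S.m f (𝟙 b)).inv ≫ p.n.hom ▷ 𝟙 b ≫ (α_ f T.m (𝟙 b)).hom ≫
          f ◁ ((ρ_ T.m).hom ≫ (λ_ T.m).inv) ≫ (α_ f (𝟙 b) T.m).inv) =
        p.n.hom ≫ (ρ_ f).inv ▷ T.m
      bicategory))

end Monads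

/-! ## Kleisli triples -/

section Kleisli

/-- A Kleisli triple over a category. -/
structure KleisliTriple (C : Type u) [Category.{v} C] where
  M : C → C
  unit (a : C) : a ⟶ M a
  bind {a b : C} (f : a ⟶ M b) : M a ⟶ M b
  bind_unit (a : C) : bind (unit a) = 𝟙 (M a)
  unit_bind {a b : C} (f : a ⟶ M b) : unit a ≫ bind f = f
  bind_bind {a b c : C} (f : a ⟶ M b) (g : b ⟶ M c) : bind f ≫ bind g = bind (f ≫ bind g)

/-- The action on morphisms of the endofunctor underlying a Kleisli triple. -/
def KleisliTriple.map {C : Type u} [Category.{v} C] (S : KleisliTriple C) {a b : C}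
    (f : a ⟶ b) : S.M a ⟶ S.M b :=
  S.bind (f ≫ S.unit b)

/-- A displayed 1-cell between Kleisli triples over a functor `F`. -/
structure KleisliTriple.Hom {C D : Type u} [Category.{v} C] [Category.{v} D] (F : C ⥤ D)
    (S : KleisliTriple C) (T : KleisliTriple D) where
  iso (a : C) : T.M (F.obj a) ≅ F.obj (S.M a)
  unit_law (a : C) : T.unit (F.obj a) ≫ (iso a).hom = F.map (S.unit a)
  bind_law {a b : C} (f : a ⟶ S.M b) :
    T.bind (F.map f ≫ (iso b).inv) ≫ (iso b).hom = (iso a).hom ≫ F.map (S.bind f)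

/-- The components of a displayed 1-cell are natural. -/
theorem KleisliTriple.Hom.naturality {C D : Type u} [Category.{v} C] [Category.{v} D] {F : C ⥤ D}
    {S : KleisliTriple C} {T : KleisliTriple D} (p : KleisliTriple.Hom F S T) {a b : C}
    (f : a ⟶ b) : T.map (F.map f) ≫ (p.iso b).hom = (p.iso a).hom ≫ F.map (S.map f) := by
  have h : F.map (S.unit b) ≫ (p.iso b).inv = T.unit (F.obj b) := by
    rw [Iso.comp_inv_eq, p.unit_law]
  rw [KleisliTriple.map, KleisliTriple.map, ← p.bind_law, F.map_comp, Category.assoc, h]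

theorem KleisliTriple.map_id {C : Type u} [Category.{v} C] (S : KleisliTriple C) (a : C) :
    S.map (𝟙 a) = 𝟙 (S.M a) := by
  rw [KleisliTriple.map, Category.id_comp, S.bind_unit]

theorem KleisliTriple.map_comp {C : Type u} [Category.{v} C] (S : KleisliTriple C) {a b c : C}
    (f : a ⟶ b) (g : b ⟶ c) : S.map (f ≫ g) = S.map f ≫ S.map g := by
  rw [KleisliTriple.map, KleisliTriple.map, KleisliTriple.map, S.bind_bind, Category.assoc,
    Category.assoc, S.unit_bind]

/-- The identity displayed 1-cell. -/
def KleisliTriple.Hom.id {C : Type u} [Category.{v} C] (S : KleisliTriple C) :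
    KleisliTriple.Hom (𝟭 C) S S where
  iso a := Iso.refl (S.M a)
  unit_law a := by simp
  bind_law f := by simp

/-- The composition of displayed 1-cells. -/
def KleisliTriple.Hom.comp {C D E : Type u} [Category.{v} C] [Category.{v} D] [Category.{v} E]
    {F : C ⥤ D} {G : D ⥤ E} {S : KleisliTriple C} {T : KleisliTriple D} {U : KleisliTriple E}
    (p : KleisliTriple.Hom F S T) (q : KleisliTriple.Hom G T U) :
    KleisliTriple.Hom (F ⋙ G) S U where
  iso a := q.iso (F.obj a) ≪≫ G.mapIso (p.iso a)
  unit_law a := by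
    change U.unit (G.obj (F.obj a)) ≫ (q.iso (F.obj a)).hom ≫ G.map (p.iso a).hom =
      G.map (F.map (S.unit a))
    rw [← Category.assoc, q.unit_law, ← G.map_comp, p.unit_law]
  bind_law {a b} f := by
    change U.bind (G.map (F.map f) ≫ G.map (p.iso b).inv ≫ (q.iso (F.obj b)).inv) ≫
        (q.iso (F.obj b)).hom ≫ G.map (p.iso b).hom =
      ((q.iso (F.obj a)).hom ≫ G.map (p.iso a).hom) ≫ G.map (F.map (S.bind f))
    rw [Category.assoc, ← G.map_comp, ← p.bind_law, G.map_comp, ← Category.assoc (q.iso _).hom,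
      ← q.bind_law, G.map_comp, Category.assoc, Category.assoc]

/-- The displayed bicategory of Kleisli triples: the displayed 2-cells over `θ` are proofs that
`θ` commutes with the displayed 1-cells. -/
abbrev kleisliDispData :
    DispBicatData.{max v u, max v u, max (u+1) (v+1), 0, max v u, max v u} Cat.{v, u} where
  Obj C := KleisliTriple C
  Hom F S T := KleisliTriple.Hom F.toFunctor S T
  Hom₂ {C _ _ _} θ {S T} p q :=
    PLift (∀ a : C, (p.iso a).hom ≫ θ.toNatTrans.app (S.M a) =
      T.map (θ.toNatTrans.app a) ≫ (q.iso a).hom)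
  id₁ S := KleisliTriple.Hom.id S
  comp₁ p q := KleisliTriple.Hom.comp p q
  id₂ {C D F S T} p := ⟨fun a => by
    change (p.iso a).hom ≫ 𝟙 (F.toFunctor.obj (S.M a)) =
      T.map (𝟙 (F.toFunctor.obj a)) ≫ (p.iso a).hom
    rw [T.map_id, Category.comp_id, Category.id_comp]⟩
  comp₂ {C D F G H θ γ S T p q r} k l := ⟨fun a => by
    change (p.iso a).hom ≫ θ.toNatTrans.app (S.M a) ≫ γ.toNatTrans.app (S.M a) =
      T.map (θ.toNatTrans.app a ≫ γ.toNatTrans.app a) ≫ (r.iso a).hom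
    rw [T.map_comp, Category.assoc, ← l.down a, ← Category.assoc, k.down a, Category.assoc]⟩

/-- The displayed bicategory of Kleisli triples. -/
abbrev kleisliDisp :
    DispBicat.{max v u, max v u, max (u+1) (v+1), 0, max v u, max v u} Cat.{v, u} :=
  DispBicat.ofProp kleisliDispData
    (fun _ _ _ _ _ => ⟨fun h k => PLift.down_injective (Subsingleton.elim (PLift.down h) (PLift.down k))⟩)
    (fun {C _ _ F G H θ S T U} p q r k => PLift.up (fun a => by
      have hk := k.down (F.toFunctor.obj a)
      change ((q.iso (F.toFunctor.obj a)).hom ≫ G.toFunctor.map (p.iso a).hom) ≫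
          θ.toNatTrans.app (F.toFunctor.obj (S.M a)) =
        U.map (θ.toNatTrans.app (F.toFunctor.obj a)) ≫
          (r.iso (F.toFunctor.obj a)).hom ≫ H.toFunctor.map (p.iso a).hom
      rw [Category.assoc, θ.toNatTrans.naturality, ← Category.assoc, hk, Category.assoc]))
    (fun {C _ _ F G θ H S T U p q} k r => PLift.up (fun a => by
      have hk := k.down a
      have hr := r.naturality (θ.toNatTrans.app a)
      change ((r.iso (F.toFunctor.obj a)).hom ≫ H.toFunctor.map (p.iso a).hom) ≫
          H.toFunctor.map (θ.toNatTrans.app (S.M a)) =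
        U.map (H.toFunctor.map (θ.toNatTrans.app a)) ≫
          (r.iso (G.toFunctor.obj a)).hom ≫ H.toFunctor.map (q.iso a).hom
      rw [← Category.assoc (U.map _), hr, Category.assoc, Category.assoc, ← Functor.map_comp,
        ← Functor.map_comp, hk]))
    (fun {_ _ _ _ F G H S T U V} p q r => PLift.up (fun a => by
      change ((r.iso (G.toFunctor.obj (F.toFunctor.obj a))).hom ≫
            H.toFunctor.map ((q.iso (F.toFunctor.obj a)).hom ≫ G.toFunctor.map (p.iso a).hom)) ≫
          𝟙 _ =
        V.map (𝟙 _) ≫ ((r.iso (G.toFunctor.obj (F.toFunctor.obj a))).hom ≫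
            H.toFunctor.map (q.iso (F.toFunctor.obj a)).hom) ≫
              H.toFunctor.map (G.toFunctor.map (p.iso a).hom)
      rw [KleisliTriple.map_id]; simp))
    (fun {_ _ _ _ F G H S T U V} p q r => PLift.up (fun a => by
      change (((r.iso (G.toFunctor.obj (F.toFunctor.obj a))).hom ≫
            H.toFunctor.map (q.iso (F.toFunctor.obj a)).hom) ≫
              H.toFunctor.map (G.toFunctor.map (p.iso a).hom)) ≫ 𝟙 _ =
        V.map (𝟙 _) ≫ (r.iso (G.toFunctor.obj (F.toFunctor.obj a))).hom ≫
            H.toFunctor.map ((q.iso (F.toFunctor.obj a)).hom ≫ G.toFunctor.map (p.iso a).hom)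
      rw [KleisliTriple.map_id]; simp))
    (fun {_ _ F S T} p => PLift.up (fun a => by
      change ((p.iso a).hom ≫ F.toFunctor.map (𝟙 _)) ≫ 𝟙 _ = T.map (𝟙 _) ≫ (p.iso a).hom
      rw [KleisliTriple.map_id]; simp))
    (fun {_ _ F S T} p => PLift.up (fun a => by
      change (p.iso a).hom ≫ 𝟙 _ = T.map (𝟙 _) ≫ (p.iso a).hom ≫ F.toFunctor.map (𝟙 _)
      rw [KleisliTriple.map_id]; simp))
    (fun {_ _ F S T} p => PLift.up (fun a => by
      change (𝟙 _ ≫ (p.iso a).hom) ≫ 𝟙 _ = T.map (𝟙 _) ≫ (p.iso a).hom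
      rw [KleisliTriple.map_id]; simp))
    (fun {_ _ F S T} p => PLift.up (fun a => by
      change (p.iso a).hom ≫ 𝟙 _ = T.map (𝟙 _) ≫ 𝟙 _ ≫ (p.iso a).hom
      rw [KleisliTriple.map_id]; simp))

end Kleisli

/-! ## Displayed structures over a locally propositional displayed bicategory -/

section OfProp

variable {B : Type u₁} [Bicategory.{w₁, v₁} B] {C : Type u₂} [Bicategory.{w₂, v₂} C]

/-! The mathematical core is the classical correspondence between the two presentations of a monad.
From a monad `(T, η, μ)` one extends `f : a ⟶ T b` to `T f ≫ μ_b`; from a Kleisli triple one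
recovers `T f` as the extension of `f ≫ η`, and `μ_a` as the extension of `𝟙 (T a)`. Functoriality
of `T` and naturality of `η` and `μ` are not part of a Kleisli triple: they follow from its three
laws (`KleisliTriple.toMonad`), just as the monad laws give the triple laws (`MonadStr.toKleisli`).

On displayed 1-cells both passages invert the comparison isomorphism, because the two definitions
orient it oppositely. Under this inversion the multiplication law and naturality together give the
bind law (`MonadStr.Hom.toKleisli`). Conversely, the multiplication law is the bind law at an
identity arrow (`KleisliTriple.Hom.toMonad`). The condition for a displayed 2-cell is the same
square with two of its sides inverted.

Neither round trip changes the object function or the unit, and the remaining operations are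
restored up to a provable equation (`KleisliTriple.toMonad_toKleisli_bind`,
`MonadStr.toKleisli_map`). Hence the comparison 1-cells of both composites lie over identity
functors and have identity components.

The bicategorical coherence costs nothing, because displayed 2-cells are proofs. Any two over the
same 2-cell agree, so every displayed law holds over the corresponding law of the base (the `ofProp`
constructions). A displayed 2-cell over an invertible 2-cell is moreover invertible (`monadDispIso`,
`kleisliDispIso`). What remains for each structural 2-cell is one equation between components. Since
the associators and unitors of `Cat` have identity components, these equations are short. -/

/-- There is at most one displayed 2-cell over any 2-cell with given ends. -/
def DispBicatData.LocallyProp (D : DispBicatData.{w₁, v₁, u₁, w₁', v₁', u₁'} B) : Prop :=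
  ∀ {a b : B} {f g : a ⟶ b} (θ : f ⟶ g) {x : D.Obj a} {y : D.Obj b} (ff : D.Hom f x y)
    (gg : D.Hom g x y), Subsingleton (D.Hom₂ θ ff gg)

/-- In the locally propositional case, displayed 2-cells in both directions form a displayed
invertible 2-cell. -/
def DispIso.ofProp {D : DispBicatData.{w₁, v₁, u₁, w₁', v₁', u₁'} B} (hD : D.LocallyProp)
    {a b : B} {f g : a ⟶ b} {e : f ≅ g} {x : D.Obj a} {y : D.Obj b}
    {ff : D.Hom f x y} {gg : D.Hom g x y} (hom : D.Hom₂ e.hom ff gg) (inv : D.Hom₂ e.inv gg ff) :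
    DispIso D e ff gg where
  hom := hom
  inv := inv
  hom_inv := D.heq_of_prop hD e.hom_inv_id _ _
  inv_hom := D.heq_of_prop hD e.inv_hom_id _ _

variable {D : DispBicat.{w₁, v₁, u₁, w₁', v₁', u₁'} B}
  {E : DispBicat.{w₂, v₂, u₂, w₂', v₂', u₂'} C}

/-- The laws of a displayed pseudofunctor to a locally propositional displayed bicategory hold
automatically. -/
def DispPseudofunctor.ofProp (hE : E.toDispBicatData.LocallyProp) (F : B ⥤ᵖ C)
    (obj : ∀ {a : B}, D.Obj a → E.Obj (F.obj a))
    (map : ∀ {a b : B} {f : a ⟶ b} {x : D.Obj a} {y : D.Obj b}, D.Hom f x y →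
      E.Hom (F.map f) (obj x) (obj y))
    (map₂ : ∀ {a b : B} {f g : a ⟶ b} {θ : f ⟶ g} {x : D.Obj a} {y : D.Obj b}
      {ff : D.Hom f x y} {gg : D.Hom g x y}, D.Hom₂ θ ff gg →
      E.Hom₂ (F.map₂ θ) (map ff) (map gg))
    (mapId : ∀ {a : B} (x : D.Obj a),
      DispIso E.toDispBicatData (F.mapId a) (map (D.id₁ x)) (E.id₁ (obj x)))
    (mapComp : ∀ {a b c : B} {f : a ⟶ b} {g : b ⟶ c} {x : D.Obj a} {y : D.Obj b} {z : D.Obj c}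
      (ff : D.Hom f x y) (gg : D.Hom g y z),
      DispIso E.toDispBicatData (F.mapComp f g) (map (D.comp₁ ff gg))
        (E.comp₁ (map ff) (map gg))) :
    DispPseudofunctor F D E where
  obj := obj
  map := map
  map₂ := map₂
  mapId := mapId
  mapComp := mapComp
  map₂_id _ := E.heq_of_prop hE (F.map₂_id _) _ _
  map₂_comp _ _ := E.heq_of_prop hE (F.map₂_comp _ _) _ _
  map₂_whiskerLeft _ _ _ _ := E.heq_of_prop hE (F.map₂_whisker_left _ _) _ _
  map₂_whiskerRight _ _ := E.heq_of_prop hE (F.map₂_whisker_right _ _) _ _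
  map₂_associator _ _ _ := E.heq_of_prop hE (F.map₂_associator _ _ _) _ _
  map₂_leftUnitor _ := E.heq_of_prop hE (F.map₂_left_unitor _) _ _
  map₂_rightUnitor _ := E.heq_of_prop hE (F.map₂_right_unitor _) _ _

variable {F G : B ⥤ᵖ C} {FF : DispPseudofunctor F D E} {GG : DispPseudofunctor G D E}

/-- The laws of a displayed pseudotransformation to a locally propositional displayed bicategory
hold automatically. -/
def DispStrongTrans.ofProp (hE : E.toDispBicatData.LocallyProp) (η : F ⟶ G)
    (app : ∀ {a : B} (x : D.Obj a), E.Hom (η.app a) (FF.obj x) (GG.obj x))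
    (naturality : ∀ {a b : B} {f : a ⟶ b} {x : D.Obj a} {y : D.Obj b} (ff : D.Hom f x y),
      DispIso E.toDispBicatData (η.naturality f)
        (E.comp₁ (FF.map ff) (app y)) (E.comp₁ (app x) (GG.map ff))) :
    DispStrongTrans η FF GG where
  app := app
  naturality := naturality
  naturality_naturality _ := E.heq_of_prop hE (η.naturality_naturality _) _ _
  naturality_id _ := E.heq_of_prop hE (η.naturality_id _) _ _
  naturality_comp _ _ := E.heq_of_prop hE (η.naturality_comp _ _) _ _

/-- The law of a displayed invertible modification to a locally propositional displayed bicategory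
holds automatically. -/
def DispInvModification.ofProp (hE : E.toDispBicatData.LocallyProp) {η θ : F ⟶ G} (m : η ≅ θ)
    {ηη : DispStrongTrans η FF GG} {θθ : DispStrongTrans θ FF GG}
    (app : ∀ {a : B} (x : D.Obj a),
      DispIso E.toDispBicatData (invModificationApp m a) (ηη.app x) (θθ.app x)) :
    DispInvModification m ηη θθ where
  app := app
  naturality _ := E.heq_of_prop hE (m.hom.as.naturality _) _ _

end OfProp

/-- Displayed 2-cells are lifted propositions, so this is proof irrelevance; the same holds for
Kleisli triples below. -/
theorem monadDispData_locallyProp (B : Type u₁) [Bicategory.{w₁, v₁} B] :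
    (monadDispData B).LocallyProp :=
  fun _ _ _ _ _ => ⟨fun _ _ => PLift.down_injective (Subsingleton.elim _ _)⟩

theorem kleisliDispData_locallyProp : kleisliDispData.{v, u}.LocallyProp :=
  fun _ _ _ _ _ => ⟨fun _ _ => PLift.down_injective (Subsingleton.elim _ _)⟩

/-! ## Monads in `Cat`, componentwise -/

section CatMonads

variable {C D : Cat.{v, u}}

/-- Composition is diagrammatic, so `η ▷ m` applies the functor after `η` and has components `T
η_a`, while `m ◁ η` has components `η_{T a}`. This decides which unit law of the monad structure
gives which of the two componentwise laws. -/
theorem MonadStr.map_unit_mul_app (S : MonadStr C) (a : C) :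
    S.m.toFunctor.map (S.unit.toNatTrans.app a) ≫ S.mul.toNatTrans.app a =
      𝟙 (S.m.toFunctor.obj a) :=
  congrArg (fun k => k.toNatTrans.app a) S.unit_mul

theorem MonadStr.unit_mul_app (S : MonadStr C) (a : C) :
    S.unit.toNatTrans.app (S.m.toFunctor.obj a) ≫ S.mul.toNatTrans.app a =
      𝟙 (S.m.toFunctor.obj a) :=
  congrArg (fun k => k.toNatTrans.app a) S.mul_unit

theorem MonadStr.mul_mul_app (S : MonadStr C) (a : C) :
    S.mul.toNatTrans.app (S.m.toFunctor.obj a) ≫ S.mul.toNatTrans.app a =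
      S.m.toFunctor.map (S.mul.toNatTrans.app a) ≫ S.mul.toNatTrans.app a :=
  -- The discarded identity is the component of the associator.
  (congrArg (fun k => k.toNatTrans.app a) S.mul_assoc).trans (Category.id_comp _)

theorem MonadStr.unit_naturality (S : MonadStr C) {a b : C} (f : a ⟶ b) :
    f ≫ S.unit.toNatTrans.app b = S.unit.toNatTrans.app a ≫ S.m.toFunctor.map f :=
  S.unit.toNatTrans.naturality f

theorem MonadStr.mul_naturality (S : MonadStr C) {a b : C} (f : a ⟶ b) :
    S.m.toFunctor.map (S.m.toFunctor.map f) ≫ S.mul.toNatTrans.app b =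
      S.mul.toNatTrans.app a ≫ S.m.toFunctor.map f :=
  S.mul.toNatTrans.naturality f

/-- A monad in `Cat` from a functor with a unit and a multiplication. -/
def MonadStr.ofFunctor (M : C ⥤ C) (unit : 𝟭 C ⟶ M) (mul : M ⋙ M ⟶ M)
    (map_unit_mul : ∀ a, M.map (unit.app a) ≫ mul.app a = 𝟙 (M.obj a))
    (unit_mul : ∀ a, unit.app (M.obj a) ≫ mul.app a = 𝟙 (M.obj a))
    (mul_mul : ∀ a, mul.app (M.obj a) ≫ mul.app a = M.map (mul.app a) ≫ mul.app a) :
    MonadStr C where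
  m := ⟨M⟩
  unit := ⟨unit⟩
  mul := ⟨mul⟩
  unit_mul := Cat.Hom₂.ext (NatTrans.ext (funext map_unit_mul))
  mul_unit := Cat.Hom₂.ext (NatTrans.ext (funext unit_mul))
  mul_assoc := Cat.Hom₂.ext (NatTrans.ext (funext fun a =>
    (mul_mul a).trans (Category.id_comp _).symm))

variable {F G : C ⟶ D} {S : MonadStr C} {T : MonadStr D}

/-- The components of the invertible 2-cell of a displayed 1-cell. -/
def MonadStr.Hom.app (p : MonadStr.Hom F S T) (a : C) :
    F.toFunctor.obj (S.m.toFunctor.obj a) ≅ T.m.toFunctor.obj (F.toFunctor.obj a) :=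
  (Cat.Hom.toNatIso p.n).app a

theorem MonadStr.Hom.app_naturality (p : MonadStr.Hom F S T) {a b : C} (f : a ⟶ b) :
    F.toFunctor.map (S.m.toFunctor.map f) ≫ (p.app b).hom =
      (p.app a).hom ≫ T.m.toFunctor.map (F.toFunctor.map f) :=
  p.n.hom.toNatTrans.naturality f

theorem MonadStr.Hom.unit_app (p : MonadStr.Hom F S T) (a : C) :
    F.toFunctor.map (S.unit.toNatTrans.app a) ≫ (p.app a).hom =
      T.unit.toNatTrans.app (F.toFunctor.obj a) :=
  (congrArg (fun k => k.toNatTrans.app a) p.unit_law).trans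
    ((Category.id_comp _).trans (Category.id_comp _))

/-- The three associators in the pasting of `mul_law` have identity components in `Cat`. Only `n` at
`S a`, the image of `n` at `a` and the multiplication of the target survive. -/
theorem MonadStr.Hom.mul_app (p : MonadStr.Hom F S T) (a : C) :
    F.toFunctor.map (S.mul.toNatTrans.app a) ≫ (p.app a).hom =
      (p.app (S.m.toFunctor.obj a)).hom ≫ T.m.toFunctor.map (p.app a).hom ≫
        T.mul.toNatTrans.app (F.toFunctor.obj a) := by
  refine (congrArg (fun k => k.toNatTrans.app a) p.mul_law).trans ?_
  change 𝟙 _ ≫ (p.app (S.m.toFunctor.obj a)).hom ≫ 𝟙 _ ≫ T.m.toFunctor.map (p.app a).hom ≫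
    𝟙 _ ≫ T.mul.toNatTrans.app (F.toFunctor.obj a) = _
  simp only [Category.id_comp]

/-- A displayed 1-cell between monads in `Cat` from its components. -/
def MonadStr.Hom.ofApp
    (n : ∀ a, F.toFunctor.obj (S.m.toFunctor.obj a) ≅ T.m.toFunctor.obj (F.toFunctor.obj a))
    (naturality : ∀ {a b : C} (f : a ⟶ b),
      F.toFunctor.map (S.m.toFunctor.map f) ≫ (n b).hom =
        (n a).hom ≫ T.m.toFunctor.map (F.toFunctor.map f))
    (unit_app : ∀ a, F.toFunctor.map (S.unit.toNatTrans.app a) ≫ (n a).hom =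
      T.unit.toNatTrans.app (F.toFunctor.obj a))
    (mul_app : ∀ a, F.toFunctor.map (S.mul.toNatTrans.app a) ≫ (n a).hom =
      (n (S.m.toFunctor.obj a)).hom ≫ T.m.toFunctor.map (n a).hom ≫
        T.mul.toNatTrans.app (F.toFunctor.obj a)) :
    MonadStr.Hom F S T where
  n := Cat.Hom.isoMk (F := S.m.toFunctor ⋙ F.toFunctor) (G := F.toFunctor ⋙ T.m.toFunctor)
    (NatIso.ofComponents n naturality)
  unit_law := Cat.Hom₂.ext (NatTrans.ext (funext fun a => (unit_app a).trans
    ((Category.id_comp _).trans (Category.id_comp _)).symm))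
  mul_law := Cat.Hom₂.ext (NatTrans.ext (funext fun a => (mul_app a).trans (by
    change _ = 𝟙 _ ≫ (n (S.m.toFunctor.obj a)).hom ≫ 𝟙 _ ≫ T.m.toFunctor.map (n a).hom ≫
      𝟙 _ ≫ T.mul.toNatTrans.app (F.toFunctor.obj a)
    simp only [Category.id_comp])))

/-- A 2-cell of `Cat` is determined by its components; this lets every displayed 2-cell of monads be
checked on objects. -/
theorem monadHom₂_iff_app {θ : F ⟶ G} {p : MonadStr.Hom F S T} {q : MonadStr.Hom G S T} :
    S.m ◁ θ ≫ q.n.hom = p.n.hom ≫ θ ▷ T.m ↔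
      ∀ a, θ.toNatTrans.app (S.m.toFunctor.obj a) ≫ (q.app a).hom =
        (p.app a).hom ≫ T.m.toFunctor.map (θ.toNatTrans.app a) :=
  ⟨fun h a => congrArg (fun k => k.toNatTrans.app a) h,
    fun h => Cat.Hom₂.ext (NatTrans.ext (funext h))⟩

theorem MonadStr.Hom.id_app (S : MonadStr C) (a : C) :
    ((MonadStr.Hom.id S).app a).hom = 𝟙 (S.m.toFunctor.obj a) :=
  Category.id_comp _

theorem MonadStr.Hom.comp_app {E : Cat.{v, u}} {F : C ⟶ D} {G : D ⟶ E} {U : MonadStr E}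
    (p : MonadStr.Hom F S T) (q : MonadStr.Hom G T U) (a : C) :
    ((p.comp q).app a).hom =
      G.toFunctor.map (p.app a).hom ≫ (q.app (F.toFunctor.obj a)).hom := by
  change 𝟙 _ ≫ G.toFunctor.map (p.app a).hom ≫ 𝟙 _ ≫ (q.app (F.toFunctor.obj a)).hom ≫ 𝟙 _ = _
  simp only [Category.id_comp, Category.comp_id]

theorem MonadStr.Hom.id_app_inv (S : MonadStr C) (a : C) :
    ((MonadStr.Hom.id S).app a).inv = 𝟙 (S.m.toFunctor.obj a) :=
  Category.id_comp _

/-- Inverting reverses the order of the factors, which gives exactly the composite isomorphism used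
for Kleisli triples. For this reason passing to Kleisli triples respects composition of displayed
1-cells with only identities to cancel. -/
theorem MonadStr.Hom.comp_app_inv {E : Cat.{v, u}} {F : C ⟶ D} {G : D ⟶ E} {U : MonadStr E}
    (p : MonadStr.Hom F S T) (q : MonadStr.Hom G T U) (a : C) :
    ((p.comp q).app a).inv =
      (q.app (F.toFunctor.obj a)).inv ≫ G.toFunctor.map (p.app a).inv := by
  change (((𝟙 _ ≫ (q.app (F.toFunctor.obj a)).inv) ≫ 𝟙 _) ≫ G.toFunctor.map (p.app a).inv) ≫
    𝟙 _ = _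
  simp only [Category.id_comp, Category.comp_id]

end CatMonads

/-! ### Displayed 2-cells over invertible 2-cells -/

/-- A displayed 2-cell of monads over an invertible 2-cell is invertible. -/
def monadDispIso {B : Type u₁} [Bicategory.{w₁, v₁} B] {a b : B} {f g : a ⟶ b} {e : f ≅ g}
    {S : MonadStr a} {T : MonadStr b} {p : MonadStr.Hom f S T} {q : MonadStr.Hom g S T}
    (h : S.m ◁ e.hom ≫ q.n.hom = p.n.hom ≫ e.hom ▷ T.m) :
    DispIso (monadDispData B) e p q :=
  DispIso.ofProp (monadDispData_locallyProp B) ⟨h⟩ ⟨by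
    -- After composing with the invertible `e.hom ▷ T.m`, the square for the inverse reduces to the
    -- given square for `e.hom`.
    rw [← cancel_mono (e.hom ▷ T.m), Category.assoc, ← h, Category.assoc,
      inv_hom_whiskerRight, Category.comp_id, whiskerLeft_inv_hom_assoc]⟩

/-- A displayed 2-cell of Kleisli triples over an invertible 2-cell is invertible. -/
def kleisliDispIso {C D : Cat.{v, u}} {F G : C ⟶ D} {e : F ≅ G}
    {S : KleisliTriple C} {T : KleisliTriple D} {p : KleisliTriple.Hom F.toFunctor S T}
    {q : KleisliTriple.Hom G.toFunctor S T}
    (h : ∀ a : C, (p.iso a).hom ≫ e.hom.toNatTrans.app (S.M a) =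
      T.map (e.hom.toNatTrans.app a) ≫ (q.iso a).hom) :
    DispIso kleisliDispData.{v, u} e p q :=
  DispIso.ofProp kleisliDispData_locallyProp ⟨h⟩ ⟨fun a => by
    have h₁ : T.map (e.inv.toNatTrans.app a) ≫ T.map (e.hom.toNatTrans.app a) = 𝟙 _ := by
      rw [← T.map_comp, Cat.Hom.inv_hom_id_toNatTrans_app, T.map_id]
    rw [← cancel_mono (e.hom.toNatTrans.app (S.M a)), Category.assoc, Category.assoc,
      Cat.Hom.inv_hom_id_toNatTrans_app, Category.comp_id, h, reassoc_of% h₁]⟩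

/-! ## Kleisli triples from monads -/

section MonadToKleisli

variable {C D : Cat.{v, u}}

/-- The Kleisli triple of a monad. -/
def MonadStr.toKleisli (S : MonadStr C) : KleisliTriple C where
  M := S.m.toFunctor.obj
  unit a := S.unit.toNatTrans.app a
  bind {_ b} f := S.m.toFunctor.map f ≫ S.mul.toNatTrans.app b
  bind_unit a := S.map_unit_mul_app a
  unit_bind {a b} f := by
    rw [← Category.assoc, ← S.unit_naturality, Category.assoc]
    exact (congrArg (f ≫ ·) (S.unit_mul_app b)).trans (Category.comp_id f)
  bind_bind {a b c} f g := by
    -- Expanded, the right side contains `T μ_c ≫ μ_c`. Associativity turns this into `μ_{T c} ≫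
    -- μ_c`, and naturality of `μ` at `g` then moves the first multiplication in front of `T g`.
    rw [Functor.map_comp, Functor.map_comp, Category.assoc, Category.assoc, Category.assoc,
      ← S.mul_mul_app, reassoc_of% S.mul_naturality g]

/-- The unit inserted by the Kleisli definition of the action is absorbed by `T η_b ≫ μ_b = 𝟙`. Thus
the functor rebuilt from the triple acts as the original one. -/
theorem MonadStr.toKleisli_map (S : MonadStr C) {a b : C} (f : a ⟶ b) :
    S.toKleisli.map f = S.m.toFunctor.map f := by
  change S.m.toFunctor.map (f ≫ S.unit.toNatTrans.app b) ≫ S.mul.toNatTrans.app b = _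
  rw [Functor.map_comp, Category.assoc]
  exact (congrArg (_ ≫ ·) (S.map_unit_mul_app b)).trans (Category.comp_id _)

variable {F : C ⟶ D} {S : MonadStr C} {T : MonadStr D}

/-- The displayed 1-cell of Kleisli triples of a displayed 1-cell of monads. -/
def MonadStr.Hom.toKleisli (p : MonadStr.Hom F S T) :
    KleisliTriple.Hom F.toFunctor S.toKleisli T.toKleisli where
  -- Monad 1-cells point from `F T_C` to `T_D F`, Kleisli 1-cells from `T_D F` to `F T_C`.
  iso a := (p.app a).symm
  unit_law a := by
    change T.unit.toNatTrans.app _ ≫ (p.app a).inv = F.toFunctor.map (S.unit.toNatTrans.app a)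
    rw [Iso.comp_inv_eq, p.unit_app]
  bind_law {a b} (f : a ⟶ S.m.toFunctor.obj b) := by
    change (T.m.toFunctor.map (F.toFunctor.map f ≫ (p.app b).hom) ≫ T.mul.toNatTrans.app _) ≫
      (p.app b).inv = (p.app a).inv ≫ F.toFunctor.map (S.m.toFunctor.map f ≫ S.mul.toNatTrans.app b)
    -- With both inverses moved across, the bind law becomes the multiplication law at `b` preceded
    -- by naturality at `f`.
    rw [Iso.comp_inv_eq, Category.assoc, Iso.eq_inv_comp, Functor.map_comp, Functor.map_comp,
      Category.assoc, Category.assoc, p.mul_app, reassoc_of% p.app_naturality f]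

end MonadToKleisli

/-- The displayed pseudofunctor sending a monad to its Kleisli triple. -/
def monadToKleisli :
    DispPseudofunctor (Pseudofunctor.id Cat.{v, u}) (monadDisp Cat.{v, u}) kleisliDisp.{v, u} :=
  DispPseudofunctor.ofProp kleisliDispData_locallyProp _
    (fun S => S.toKleisli)
    (fun p => p.toKleisli)
    (fun {C _ F G θ S T p q} h => ⟨fun (a : C) => by
      refine Eq.trans ?_ (congrArg (· ≫ (q.app a).inv) (T.toKleisli_map _)).symm
      change (p.app a).inv ≫ θ.toNatTrans.app (S.m.toFunctor.obj a) =
        T.m.toFunctor.map (θ.toNatTrans.app a) ≫ (q.app a).inv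
      -- This is the square for monads with its two comparison isomorphisms inverted.
      rw [Iso.inv_comp_eq, ← reassoc_of% (monadHom₂_iff_app.1 h.down a),
        Iso.hom_inv_id, Category.comp_id]⟩)
    (fun {C} S => kleisliDispIso fun (a : C) => by
      refine Eq.trans ?_ (congrArg (· ≫ 𝟙 _) (S.toKleisli.map_id a)).symm
      exact congrArg (· ≫ 𝟙 _) (MonadStr.Hom.id_app_inv S a))
    (fun {C _ _ F G S T U} p q => kleisliDispIso fun (a : C) => by
      refine Eq.trans ?_ (congrArg (· ≫ _) (U.toKleisli.map_id _)).symm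
      exact (Category.comp_id _).trans
        ((MonadStr.Hom.comp_app_inv p q a).trans (Category.id_comp _).symm))

/-! ## Monads from Kleisli triples -/

section KleisliToMonad

/-- With `bind_map`, this expresses naturality of extension in its source and target. Taking an
identity arrow in either lemma gives the two halves of the naturality of `μ`. -/
theorem KleisliTriple.map_bind {C : Type u} [Category.{v} C] (S : KleisliTriple C) {a b c : C}
    (f : a ⟶ b) (g : b ⟶ S.M c) : S.map f ≫ S.bind g = S.bind (f ≫ g) := by
  rw [KleisliTriple.map, S.bind_bind, Category.assoc, S.unit_bind]

theorem KleisliTriple.bind_map {C : Type u} [Category.{v} C] (S : KleisliTriple C) {a b c : C}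
    (f : a ⟶ S.M b) (g : b ⟶ c) : S.bind f ≫ S.map g = S.bind (f ≫ S.map g) :=
  S.bind_bind _ _

variable {C D : Cat.{v, u}}

/-- The endofunctor of a Kleisli triple. -/
def KleisliTriple.functor {C : Type u} [Category.{v} C] (S : KleisliTriple C) : C ⥤ C where
  obj := S.M
  map f := S.map f
  map_id := S.map_id
  map_comp := S.map_comp

/-- The monad of a Kleisli triple. -/
def KleisliTriple.toMonad (S : KleisliTriple C) : MonadStr C :=
  MonadStr.ofFunctor S.functor
    { app := S.unit
      naturality := fun _ b f => (S.unit_bind (f ≫ S.unit b)).symm }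
    { app := fun a => S.bind (𝟙 (S.M a))
      naturality := fun a b f => by
        change S.map (S.map f) ≫ S.bind (𝟙 (S.M b)) = S.bind (𝟙 (S.M a)) ≫ S.map f
        rw [S.map_bind, S.bind_map, Category.comp_id, Category.id_comp] }
    (fun a => by
      change S.map (S.unit a) ≫ S.bind (𝟙 (S.M a)) = 𝟙 (S.M a)
      rw [S.map_bind, Category.comp_id, S.bind_unit])
    (fun a => S.unit_bind (𝟙 (S.M a)))
    (fun a => by
      -- Both composites are equal to the extension of `S.bind (𝟙 (S.M a))`.
      change S.bind (𝟙 (S.M (S.M a))) ≫ S.bind (𝟙 (S.M a)) =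
        S.map (S.bind (𝟙 (S.M a))) ≫ S.bind (𝟙 (S.M a))
      rw [S.bind_bind, S.map_bind, Category.id_comp, Category.comp_id])

variable {F : C ⟶ D} {S : KleisliTriple C} {T : KleisliTriple D}

/-- The displayed 1-cell of monads of a displayed 1-cell of Kleisli triples. -/
def KleisliTriple.Hom.toMonad (p : KleisliTriple.Hom F.toFunctor S T) :
    MonadStr.Hom F S.toMonad T.toMonad :=
  MonadStr.Hom.ofApp (fun a => (p.iso a).symm)
    (fun {a b} f => by
      change F.toFunctor.map (S.map f) ≫ (p.iso b).inv =
        (p.iso a).inv ≫ T.map (F.toFunctor.map f)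
      rw [Iso.comp_inv_eq, Category.assoc, p.naturality, Iso.inv_hom_id_assoc])
    (fun a => by
      change F.toFunctor.map (S.unit a) ≫ (p.iso a).inv = T.unit (F.toFunctor.obj a)
      rw [Iso.comp_inv_eq, p.unit_law])
    (fun a => by
      change F.toFunctor.map (S.bind (𝟙 (S.M a))) ≫ (p.iso a).inv =
        (p.iso (S.M a)).inv ≫ T.map (p.iso a).inv ≫ T.bind (𝟙 (T.M (F.toFunctor.obj a)))
      -- Multiplication is the extension of an identity, so its compatibility is the bind law at
      -- that identity. On the target side, `map_bind` merges the last two factors into the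
      -- extension of `(p.iso a).inv`.
      have h := p.bind_law (𝟙 (S.M a))
      rw [F.toFunctor.map_id, Category.id_comp] at h
      rw [T.map_bind, Category.comp_id, Iso.comp_inv_eq, Category.assoc, h, Iso.inv_hom_id_assoc])

end KleisliToMonad

/-- The displayed pseudofunctor sending a Kleisli triple to its monad. -/
def kleisliToMonad :
    DispPseudofunctor (Pseudofunctor.id Cat.{v, u}) kleisliDisp.{v, u} (monadDisp Cat.{v, u}) :=
  DispPseudofunctor.ofProp (monadDispData_locallyProp _) _
    (fun S => S.toMonad)
    (fun p => p.toMonad)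
    (fun {C _ F G θ S T p q} h => ⟨monadHom₂_iff_app.2 fun (a : C) => by
      change θ.toNatTrans.app (S.M a) ≫ (q.iso a).inv =
        (p.iso a).inv ≫ T.map (θ.toNatTrans.app a)
      rw [Iso.eq_inv_comp, reassoc_of% (h.down a), Iso.hom_inv_id, Category.comp_id]⟩)
    (fun {C} S => monadDispIso <| monadHom₂_iff_app.2 fun (a : C) => by
      change 𝟙 (S.M a) ≫ ((MonadStr.Hom.id S.toMonad).app a).hom =
        𝟙 (S.M a) ≫ S.map (𝟙 a)
      rw [S.map_id, MonadStr.Hom.id_app]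
      rfl)
    (fun {C _ _ F G S T U} p q => monadDispIso <| monadHom₂_iff_app.2 fun (a : C) => by
      change 𝟙 (G.toFunctor.obj (F.toFunctor.obj (S.M a))) ≫ ((p.toMonad.comp q.toMonad).app a).hom =
        (G.toFunctor.map (p.iso a).inv ≫ (q.iso (F.toFunctor.obj a)).inv) ≫ U.map (𝟙 _)
      rw [U.map_id, Category.comp_id, MonadStr.Hom.comp_app]
      exact Category.id_comp _)

/-! ## The two composites -/

section Composites

variable {C : Cat.{v, u}}

/-- The round trip extends `f` as `T f` followed by the extension of an identity, and `map_bind`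
merges the two. The operations agree by a proof rather than by definition, hence the explicit
comparison 1-cells with identity components. -/
theorem KleisliTriple.toMonad_toKleisli_bind (S : KleisliTriple C) {a b : C} (f : a ⟶ S.M b) :
    S.toMonad.toKleisli.bind f = S.bind f :=
  (S.map_bind f (𝟙 (S.M b))).trans (congrArg S.bind (Category.comp_id f))

theorem KleisliTriple.toMonad_toKleisli_map (S : KleisliTriple C) {a b : C} (f : a ⟶ b) :
    S.toMonad.toKleisli.map f = S.map f :=
  S.toMonad.toKleisli_map f

/-- The displayed 1-cell over the identity from the Kleisli triple of the monad of a Kleisli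
triple to that Kleisli triple. -/
def KleisliTriple.unitHom (S : KleisliTriple C) :
    KleisliTriple.Hom (𝟭 C) S.toMonad.toKleisli S where
  iso a := Iso.refl (S.M a)
  unit_law a := Category.comp_id (S.unit a)
  bind_law {a b} (f : a ⟶ S.M b) := by
    change S.bind (f ≫ 𝟙 (S.M b)) ≫ 𝟙 (S.M b) = 𝟙 (S.M a) ≫ S.toMonad.toKleisli.bind f
    rw [Category.comp_id, Category.comp_id, S.toMonad_toKleisli_bind]
    exact (Category.id_comp _).symm

/-- The displayed 1-cell over the identity from a Kleisli triple to the Kleisli triple of its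
monad. -/
def KleisliTriple.unitInvHom (S : KleisliTriple C) :
    KleisliTriple.Hom (𝟭 C) S S.toMonad.toKleisli where
  iso a := Iso.refl (S.M a)
  unit_law a := Category.comp_id (S.unit a)
  bind_law {a b} f := by
    refine (Category.comp_id _).trans ((S.toMonad_toKleisli_bind (f ≫ 𝟙 (S.M b))).trans ?_)
    rw [Category.comp_id]
    exact (Category.id_comp _).symm

/-- The displayed 1-cell over the identity from the monad of the Kleisli triple of a monad to
that monad. -/
def MonadStr.counitHom (S : MonadStr C) : MonadStr.Hom (𝟙 C) S.toKleisli.toMonad S :=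
  MonadStr.Hom.ofApp (fun a => Iso.refl (S.m.toFunctor.obj a))
    (fun {a b} f => by
      change S.toKleisli.map f ≫ 𝟙 (S.m.toFunctor.obj b) =
        𝟙 (S.m.toFunctor.obj a) ≫ S.m.toFunctor.map f
      rw [S.toKleisli_map, Category.id_comp]
      exact Category.comp_id _)
    (fun a => Category.comp_id (S.unit.toNatTrans.app a))
    (fun a => by
      -- The multiplication rebuilt from the triple is `T 𝟙 ≫ μ_a`. On the right, the same `T 𝟙` is
      -- the image of the identity component.
      change (S.m.toFunctor.map (𝟙 (S.m.toFunctor.obj a)) ≫ S.mul.toNatTrans.app a) ≫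
        𝟙 (S.m.toFunctor.obj a) = 𝟙 (S.m.toFunctor.obj (S.m.toFunctor.obj a)) ≫
          S.m.toFunctor.map (𝟙 (S.m.toFunctor.obj a)) ≫ S.mul.toNatTrans.app a
      rw [Category.comp_id, Category.id_comp])

/-- The displayed 1-cell over the identity from a monad to the monad of its Kleisli triple. -/
def MonadStr.counitInvHom (S : MonadStr C) : MonadStr.Hom (𝟙 C) S S.toKleisli.toMonad :=
  MonadStr.Hom.ofApp (fun a => Iso.refl (S.m.toFunctor.obj a))
    (fun {a b} f => by
      change S.m.toFunctor.map f ≫ 𝟙 (S.m.toFunctor.obj b) =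
        𝟙 (S.m.toFunctor.obj a) ≫ S.toKleisli.map f
      rw [S.toKleisli_map, Category.comp_id]
      exact (Category.id_comp _).symm)
    (fun a => Category.comp_id (S.unit.toNatTrans.app a))
    (fun a => by
      change S.mul.toNatTrans.app a ≫ 𝟙 (S.m.toFunctor.obj a) =
        𝟙 (S.m.toFunctor.obj (S.m.toFunctor.obj a)) ≫
          S.toKleisli.map (𝟙 (S.m.toFunctor.obj a)) ≫
            S.m.toFunctor.map (𝟙 (S.m.toFunctor.obj a)) ≫ S.mul.toNatTrans.app a
      rw [S.toKleisli_map, Category.comp_id, Category.id_comp]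
      -- In this direction `T 𝟙` occurs twice: once as the image of the identity component, once
      -- inside the rebuilt multiplication.
      have h := S.m.toFunctor.map_id (S.m.toFunctor.obj a)
      exact ((congrArg₂ (· ≫ ·) h (congrArg (· ≫ _) h)).trans
        ((Category.id_comp _).trans (Category.id_comp _))).symm)

end Composites

/-! ## The displayed biequivalence -/

/-- The displayed pseudotransformation from Kleisli triples of monads of Kleisli triples to the
identity. -/
def kleisliUnit :
    DispStrongTrans (idCompIdHom Cat.{v, u}) (kleisliToMonad.comp monadToKleisli)
      (DispPseudofunctor.id kleisliDisp.{v, u}) :=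
  DispStrongTrans.ofProp kleisliDispData_locallyProp _
    (fun S => S.unitHom)
    (fun {C _ F S T} p => kleisliDispIso fun (a : C) => by
      -- The base 2-cell is a right unitor followed by an inverse left unitor, so its components are
      -- identities. Both sides then reduce to `(p.iso a).hom`.
      change (𝟙 (T.M (F.toFunctor.obj a)) ≫ (p.iso a).hom) ≫ 𝟙 _ ≫ 𝟙 _ =
        T.map (𝟙 (F.toFunctor.obj a) ≫ 𝟙 (F.toFunctor.obj a)) ≫
          (p.iso a).hom ≫ F.toFunctor.map (𝟙 (S.M a))
      rw [Category.comp_id (𝟙 (F.toFunctor.obj a)), T.map_id, F.toFunctor.map_id]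
      simp)

/-- The displayed pseudotransformation from the identity to Kleisli triples of monads of Kleisli
triples. -/
def kleisliUnitInv :
    DispStrongTrans (idCompIdInv Cat.{v, u}) (DispPseudofunctor.id kleisliDisp.{v, u})
      (kleisliToMonad.comp monadToKleisli) :=
  DispStrongTrans.ofProp kleisliDispData_locallyProp _
    (fun S => S.unitInvHom)
    (fun {C _ F S T} p => kleisliDispIso fun (a : C) => by
      -- The target now carries the rebuilt triple, whose action on arrows is first replaced by that
      -- of `T`.
      refine Eq.trans ?_ (congrArg (· ≫ _) (T.toMonad_toKleisli_map _)).symm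
      change (𝟙 (T.M (F.toFunctor.obj a)) ≫ (p.iso a).hom) ≫ 𝟙 _ ≫ 𝟙 _ =
        T.map (𝟙 (F.toFunctor.obj a) ≫ 𝟙 (F.toFunctor.obj a)) ≫
          (p.iso a).hom ≫ F.toFunctor.map (𝟙 (S.M a))
      rw [Category.comp_id (𝟙 (F.toFunctor.obj a)), T.map_id, F.toFunctor.map_id]
      simp)

/-- The displayed pseudotransformation from monads of Kleisli triples of monads to the
identity. -/
def monadCounit :
    DispStrongTrans (idCompIdHom Cat.{v, u}) (monadToKleisli.comp kleisliToMonad)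
      (DispPseudofunctor.id (monadDisp Cat.{v, u})) :=
  DispStrongTrans.ofProp (monadDispData_locallyProp _) _
    (fun S => S.counitHom)
    (fun {C _ F S T} p => monadDispIso <| monadHom₂_iff_app.2 fun (a : C) => by
      -- The composites with the comparison 1-cells are expanded on components. The 1-cell
      -- `p.toKleisli.toMonad` has the components of `p`, having been inverted twice.
      refine Eq.trans (congrArg (_ ≫ ·) (MonadStr.Hom.comp_app S.counitHom p a)) (Eq.trans ?_
        (congrArg (· ≫ _) (MonadStr.Hom.comp_app p.toKleisli.toMonad T.counitHom a)).symm)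
      change (𝟙 _ ≫ 𝟙 _) ≫ F.toFunctor.map (𝟙 (S.m.toFunctor.obj a)) ≫ (p.app a).hom =
        ((p.app a).hom ≫ 𝟙 (T.m.toFunctor.obj (F.toFunctor.obj a))) ≫
          T.m.toFunctor.map (𝟙 (F.toFunctor.obj a) ≫ 𝟙 (F.toFunctor.obj a))
      simp)

/-- The displayed pseudotransformation from the identity to monads of Kleisli triples of
monads. -/
def monadCounitInv :
    DispStrongTrans (idCompIdInv Cat.{v, u}) (DispPseudofunctor.id (monadDisp Cat.{v, u}))
      (monadToKleisli.comp kleisliToMonad) :=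
  DispStrongTrans.ofProp (monadDispData_locallyProp _) _
    (fun S => S.counitInvHom)
    (fun {C _ F S T} p => monadDispIso <| monadHom₂_iff_app.2 fun (a : C) => by
      refine Eq.trans
        (congrArg (_ ≫ ·) (MonadStr.Hom.comp_app S.counitInvHom p.toKleisli.toMonad a))
        (Eq.trans ?_ (congrArg₂ (· ≫ ·) (MonadStr.Hom.comp_app p T.counitInvHom a)
          (T.toKleisli_map _)).symm)
      change (𝟙 _ ≫ 𝟙 _) ≫ F.toFunctor.map (𝟙 (S.m.toFunctor.obj a)) ≫ (p.app a).hom =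
        ((p.app a).hom ≫ 𝟙 (T.m.toFunctor.obj (F.toFunctor.obj a))) ≫
          T.m.toFunctor.map (𝟙 (F.toFunctor.obj a) ≫ 𝟙 (F.toFunctor.obj a))
      simp)

/-! ### Isomorphisms from the composite comparison 1-cells to identities -/

section Modifications

variable {C : Cat.{v, u}}

/-- The first composite of the comparison 1-cells of Kleisli triples is isomorphic to the
identity. -/
def KleisliTriple.unitHomCompUnitInvHom (S : KleisliTriple C) :
    DispIso kleisliDispData.{v, u} (λ_ (𝟙 C)) (S.unitHom.comp S.unitInvHom)
      (KleisliTriple.Hom.id S.toMonad.toKleisli) :=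
  kleisliDispIso fun a => by
    refine Eq.trans ?_ (congrArg (· ≫ _) (S.toMonad_toKleisli_map _)).symm
    change (𝟙 (S.M a) ≫ 𝟙 (S.M a)) ≫ 𝟙 (S.M a) = S.map (𝟙 a) ≫ 𝟙 (S.M a)
    rw [S.map_id, Category.comp_id]

/-- The second composite of the comparison 1-cells of Kleisli triples is isomorphic to the
identity. -/
def KleisliTriple.unitInvHomCompUnitHom (S : KleisliTriple C) :
    DispIso kleisliDispData.{v, u} (λ_ (𝟙 C)) (S.unitInvHom.comp S.unitHom)
      (KleisliTriple.Hom.id S) :=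
  kleisliDispIso fun a => by
    change (𝟙 (S.M a) ≫ 𝟙 (S.M a)) ≫ 𝟙 (S.M a) = S.map (𝟙 a) ≫ 𝟙 (S.M a)
    rw [S.map_id, Category.comp_id]

/-- The first composite of the comparison 1-cells of monads is isomorphic to the identity. -/
def MonadStr.counitHomCompCounitInvHom (S : MonadStr C) :
    DispIso (monadDispData Cat.{v, u}) (λ_ (𝟙 C)) (S.counitHom.comp S.counitInvHom)
      (MonadStr.Hom.id S.toKleisli.toMonad) :=
  monadDispIso <| monadHom₂_iff_app.2 fun a => by
    refine Eq.trans (congrArg (_ ≫ ·) (MonadStr.Hom.id_app S.toKleisli.toMonad a)) (Eq.trans ?_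
      (congrArg₂ (· ≫ ·) (MonadStr.Hom.comp_app S.counitHom S.counitInvHom a)
        (S.toKleisli_map (𝟙 a))).symm)
    change 𝟙 (S.m.toFunctor.obj a) ≫ 𝟙 (S.m.toFunctor.obj a) =
      (𝟙 (S.m.toFunctor.obj a) ≫ 𝟙 (S.m.toFunctor.obj a)) ≫ S.m.toFunctor.map (𝟙 a)
    rw [S.m.toFunctor.map_id, Category.comp_id, Category.comp_id]

/-- The second composite of the comparison 1-cells of monads is isomorphic to the identity. -/
def MonadStr.counitInvHomCompCounitHom (S : MonadStr C) :
    DispIso (monadDispData Cat.{v, u}) (λ_ (𝟙 C)) (S.counitInvHom.comp S.counitHom)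
      (MonadStr.Hom.id S) :=
  monadDispIso <| monadHom₂_iff_app.2 fun a => by
    refine Eq.trans (congrArg (_ ≫ ·) (MonadStr.Hom.id_app S a)) (Eq.trans ?_
      (congrArg (· ≫ _) (MonadStr.Hom.comp_app S.counitInvHom S.counitHom a)).symm)
    change 𝟙 (S.m.toFunctor.obj a) ≫ 𝟙 (S.m.toFunctor.obj a) =
      (𝟙 (S.m.toFunctor.obj a) ≫ 𝟙 (S.m.toFunctor.obj a)) ≫ S.m.toFunctor.map (𝟙 a)
    rw [S.m.toFunctor.map_id, Category.comp_id, Category.comp_id]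

end Modifications

/-- The displayed biequivalence between monads in `Cat` and Kleisli triples, over the identity
biequivalence. -/
def monadKleisliDispBiequivalence :
    DispBiequivalence (Biequivalence.refl Cat.{v, u}) (monadDisp Cat.{v, u})
      kleisliDisp.{v, u} where
  L := monadToKleisli
  R := kleisliToMonad
  unit := kleisliUnit
  unitInv := kleisliUnitInv
  counit := monadCounit
  counitInv := monadCounitInv
  -- All four modifications of the identity biequivalence have component `λ_ (𝟙 C)`, the 2-cell over
  -- which the isomorphisms above lie.
  m₁ := DispInvModification.ofProp kleisliDispData_locallyProp _
    fun S => S.unitHomCompUnitInvHom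
  m₂ := DispInvModification.ofProp kleisliDispData_locallyProp _
    fun S => S.unitInvHomCompUnitHom
  m₃ := DispInvModification.ofProp (monadDispData_locallyProp _) _
    fun S => S.counitHomCompCounitInvHom
  m₄ := DispInvModification.ofProp (monadDispData_locallyProp _) _
    fun S => S.counitInvHomCompCounitHom

/-- The equation forces the second witness to be the total biequivalence of the first, so the
statement about total bicategories is a consequence of the displayed one. -/
theorem mainTheorem9 :
    ∃ (D : DispBiequivalence (Biequivalence.refl Cat.{v, u}) (monadDisp Cat.{v, u})
        kleisliDisp.{v, u})
      (E : Biequivalence (TotalBicat (monadDisp Cat.{v, u})) (TotalBicat kleisliDisp.{v, u})),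
      E = D.total :=
  ⟨monadKleisliDispBiequivalence, monadKleisliDispBiequivalence.total, rfl⟩
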